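/- Let $\eta\in\mathbb{C}$ with $\operatorname{Im}\eta>0$ and put $q=e^{2i\eta}$, $q^{1/2}=e^{i\eta}$, $q^{3/2}=e^{3i\eta}$ (so $0<|q|<1$). Let $a_1,\dots,a_6\in\mathbb{C}$, let $\sigma_k$ (resp. $\tilde\sigma_k$) be the $k$-th elementary symmetric function of $a_1,\dots,a_6$ (resp. of $q^{-1/2}a_1,\dots,q^{-1/2}a_6$), and assume $|q|<|\sigma_6|$. Write $z=e^{i\theta}$, $x=\cos\theta$, $y_\pm=\cos(\theta\pm\eta)=\frac12(q^{\pm1/2}z+q^{\mp1/2}z^{-1})$, $\Delta y=y_+-y_-$, and $$\mathbb{D}f(x)=\frac{f(y_+)-f(y_-)}{y_+-y_-},\qquad \mathbb{M}f(x)=\tfrac12\,[f(y_+)+f(y_-)] .$$ Consider the weight $$w(\theta)=\frac{(z^{3},z^{-3};q^{3/2})_\infty}{\sin(\frac32\theta)\prod_{j=1}^{6}(a_jz,a_jz^{-1};q)_\infty}$$ and the polynomials $$W(x)=4(1+\tilde\sigma_6)x^3-2(\tilde\sigma_1+\tilde\sigma_5)x^2+(\tilde\sigma_2+\tilde\sigma_4-3-3\tilde\sigma_6)x+\tilde\sigma_1-\tilde\sigma_3+\tilde\sigma_5,$$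 $$V(x)=\frac{-4(1-\tilde\sigma_6)x^2+2(\tilde\sigma_1-\tilde\sigma_5)x+1-\tilde\sigma_2+\tilde\sigma_4-\tilde\sigma_6}{q^{1/2}-q^{-1/2}},$$ which satisfy $W\pm\Delta y\,V=z^{\mp3}\prod_{j=1}^6(1-a_jq^{-1/2}z^{\pm1})$. Let $\int_{\mathfrak G}\mathbb{D}x\,F$ denote either of the following. (a) The lattice sum $\sum_{s\in\mathbb{Z}}\Delta y(\theta_s)F(\theta_s)$, $\theta_s=\theta_0+2s\eta$, with support $\mathfrak G=\{\cos\theta_s:s\in\mathbb{Z}\}$, where $\theta_0\in\mathbb{C}$ is such that $a_je^{i\theta_0},a_je^{-i\theta_0}\notin q^{\mathbb{Z}}$ for all $j$. In this case let $S$ be the set of all $\theta\in\mathbb{C}$ with $\sin\theta\ne0$ and $y_\pm\notin\mathfrak G$. (b) For $\operatorname{Re}\eta=0$ (so $0<q<1$), $|a_j|<1$ and $a_j\notin(-\infty,0]$ for all $j$: the contour integral $\frac12\int_C F(\theta)\sin\theta\,d\theta$, where $C$ runs along straight lines from $-\pi-i\infty$ to $-\pi$, to $\pi$, to $\pi-i\infty$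 (in the variable $z$: the unit circle together with a Hankel tail around the cut $(-\infty,0)$), with support $\mathfrak G=\cos(C)=(-\infty,1]$. In this case let $S$ be the set of all $\theta\in\mathbb{C}$ with $|z|>q^{-1/2}$ and $z\notin(-\infty,0)$. Then in both cases the moments $m_{0,0}=\int_{\mathfrak G}\mathbb{D}x\,w$ and $m_{0,\pm}=\int_{\mathfrak G}\mathbb{D}x\,w\,z^{\pm1}$ converge absolutely, and so does the Stieltjes function $f(x)=\int_{\mathfrak G}\mathbb{D}y\,\dfrac{w(y)}{x-y}$ for every $x\notin\mathfrak G$. Moreover a polynomial $U\in\mathbb{C}[x]$ satisfies $$W(x)\,\mathbb{D}f(x)=2V(x)\,\mathbb{M}f(x)+U(x)\qquad\text{for all }x=\cos\theta,\ \theta\in S,$$ if and only if $$U(x)=\frac{4}{q^2(q^{1/2}-q^{-1/2})}\Big[m_{0,0}\big(-2q^{-1/2}(\sigma_6-q^2)x+\sigma_5-q\sigma_1\big)-(\sigma_6-q)(m_{0,+}+m_{0,-})\Big].$$ -/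

import Mathlib

open Complex Polynomial

namespace QQuadratic

noncomputable section

/-!
Everything is parametrised by `η` with `q = exp (2 i η)`, `q^(1/2) = exp (i η)`,
`q^(3/2) = exp (3 i η)`, and by the angle `θ` with `z = exp (i θ)`, `x = cos θ`.
The angle uniformises the half-integer powers of `z` that occur in the weight.
-/

/-- The base `q = exp (2 i η)`. -/
def base (η : ℂ) : ℂ := exp (2 * I * η)

/-- The square root `q^(1/2) = exp (i η)` of the base. -/
def baseHalf (η : ℂ) : ℂ := exp (I * η)

/-- The infinite `q`-Pochhammer symbol `(c; p)_∞ = ∏_{k ≥ 0} (1 - c p^k)`. -/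
def qPoch (c p : ℂ) : ℂ := ∏' k : ℕ, (1 - c * p ^ k)

/-- The `k`-th elementary symmetric function of `a_1, …, a_6`. -/
def sigma (a : Fin 6 → ℂ) (k : ℕ) : ℂ :=
  ∑ t ∈ (Finset.univ : Finset (Fin 6)).powersetCard k, ∏ j ∈ t, a j

/-- The `k`-th elementary symmetric function of `q^(-1/2) a_1, …, q^(-1/2) a_6`. -/
def sigmaTilde (η : ℂ) (a : Fin 6 → ℂ) (k : ℕ) : ℂ :=
  sigma (fun j => (baseHalf η)⁻¹ * a j) k

/-- `Δy = y₊ - y₋` at `x = cos θ`, where `y_± = cos (θ ± η)` is `(q^(±1/2) z + q^(∓1/2) z⁻¹) / 2`. -/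
def deltaY (η θ : ℂ) : ℂ := cos (θ + η) - cos (θ - η)

/-- The Askey-Wilson divided difference `(𝔻 f)(x)` at `x = cos θ`. -/
def awD (η : ℂ) (f : ℂ → ℂ) (θ : ℂ) : ℂ :=
  (f (cos (θ + η)) - f (cos (θ - η))) / deltaY η θ

/-- The Askey-Wilson mean `(𝕄 f)(x)` at `x = cos θ`. -/
def awM (η : ℂ) (f : ℂ → ℂ) (θ : ℂ) : ℂ :=
  (f (cos (θ + η)) + f (cos (θ - η))) / 2

/-- The weight for `N = 3`, as a function of the angle:
`(z^3, z^(-3); q^(3/2))_∞ / (sin (3θ/2) ∏_j (a_j z, a_j z⁻¹; q)_∞)`. -/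
def weight (η : ℂ) (a : Fin 6 → ℂ) (θ : ℂ) : ℂ :=
  (qPoch (exp (3 * I * θ)) (exp (3 * I * η)) * qPoch (exp (-(3 * I * θ))) (exp (3 * I * η))) /
    (sin (3 * θ / 2) *
      ∏ j, (qPoch (a j * exp (I * θ)) (base η) * qPoch (a j * exp (-(I * θ))) (base η)))

/-- The spectral data polynomial `W` for `N = 3`. -/
def specW (η : ℂ) (a : Fin 6 → ℂ) : ℂ[X] :=
  C (4 * (1 + sigmaTilde η a 6)) * X ^ 3
    - C (2 * (sigmaTilde η a 1 + sigmaTilde η a 5)) * X ^ 2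
    + C (sigmaTilde η a 2 + sigmaTilde η a 4 - 3 - 3 * sigmaTilde η a 6) * X
    + C (sigmaTilde η a 1 - sigmaTilde η a 3 + sigmaTilde η a 5)

/-- The spectral data polynomial `V` for `N = 3`. -/
def specV (η : ℂ) (a : Fin 6 → ℂ) : ℂ[X] :=
  C (1 / (baseHalf η - (baseHalf η)⁻¹)) *
    (C (-4 * (1 - sigmaTilde η a 6)) * X ^ 2
      + C (2 * (sigmaTilde η a 1 - sigmaTilde η a 5)) * X
      + C (1 - sigmaTilde η a 2 + sigmaTilde η a 4 - sigmaTilde η a 6))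

/-! ### The two realisations of the integral over the support

In both, the integrand `F` is a function of the angle, so that it may contain `w` and `z^{±1}`. -/

/-- The lattice sum `∑_{s ∈ ℤ} Δy(x_s) F(x_s)` over `θ_s = θ₀ + 2 s η`,
that is `z_s = z₀ q^s`. -/
def latticeInt (η θ₀ : ℂ) (F : ℂ → ℂ) : ℂ :=
  ∑' s : ℤ, deltaY η (θ₀ + 2 * s * η) * F (θ₀ + 2 * s * η)

/-- Absolute convergence of the lattice sum. -/
def LatticeIntegrable (η θ₀ : ℂ) (F : ℂ → ℂ) : Prop :=
  Summable fun s : ℤ => deltaY η (θ₀ + 2 * s * η) * F (θ₀ + 2 * s * η)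

/-- The lattice of the points `x_s = cos θ_s`. -/
def latticeSupport (η θ₀ : ℂ) : Set ℂ := Set.range fun s : ℤ => cos (θ₀ + 2 * s * η)

/-- The contour integral `(1/2) ∫_C F(θ) sin θ dθ`, where `C` runs from `-π - i∞` to `-π`, then
to `π`, then to `π - i∞`. In the variable `z = exp (i θ)` this is the unit circle together with
the Hankel tail that comes in from `∞ e^{-πi}` below the cut `(-∞, 0)` and leaves to `∞ e^{πi}`
above it; for `F = weight` the value is `π I₃(a_1, …, a_6)`. In the variable `x = cos θ` it is
`∫ F dx` over `(-1, 1)`, continued through the endpoint `-1` to `-∞`. -/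
def contourInt (F : ℂ → ℂ) : ℂ :=
  (1 / 2) *
    ((∫ t in (-Real.pi)..Real.pi, F (t : ℂ) * sin (t : ℂ))
      + I * (∫ r in Set.Ioi (0 : ℝ), F (-(Real.pi : ℂ) - I * r) * sin (-(Real.pi : ℂ) - I * r))
      - I * (∫ r in Set.Ioi (0 : ℝ), F ((Real.pi : ℂ) - I * r) * sin ((Real.pi : ℂ) - I * r)))

/-- Absolute convergence of the three pieces of the contour integral. -/
def ContourIntegrable (F : ℂ → ℂ) : Prop :=
  IntervalIntegrable (fun t : ℝ => F (t : ℂ) * sin (t : ℂ)) MeasureTheory.volume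
      (-Real.pi) Real.pi ∧
    MeasureTheory.IntegrableOn
      (fun r : ℝ => F (-(Real.pi : ℂ) - I * r) * sin (-(Real.pi : ℂ) - I * r)) (Set.Ioi 0) ∧
    MeasureTheory.IntegrableOn
      (fun r : ℝ => F ((Real.pi : ℂ) - I * r) * sin ((Real.pi : ℂ) - I * r)) (Set.Ioi 0)

/-- The image of the contour under `x = cos θ`, the real half-line `(-∞, 1]`. -/
def contourSupport : Set ℂ := {x | x.im = 0 ∧ x.re ≤ 1}

/-! ### Moments, Stieltjes function and the polynomial `U`

`J` stands for one of the two integrals above. -/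

/-- `m_{0,0}`, the integral of `w`. -/
def moment00 (J : (ℂ → ℂ) → ℂ) (η : ℂ) (a : Fin 6 → ℂ) : ℂ := J (weight η a)

/-- `m_{0,+}`, the integral of `w z`. -/
def momentPlus (J : (ℂ → ℂ) → ℂ) (η : ℂ) (a : Fin 6 → ℂ) : ℂ :=
  J fun θ => weight η a θ * exp (I * θ)

/-- `m_{0,-}`, the integral of `w z⁻¹`. -/
def momentMinus (J : (ℂ → ℂ) → ℂ) (η : ℂ) (a : Fin 6 → ℂ) : ℂ :=
  J fun θ => weight η a θ * exp (-(I * θ))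

/-- The integrand `w(y) / (x - y)`, `y = cos φ`, of the Stieltjes function. -/
def stieltjesKernel (η : ℂ) (a : Fin 6 → ℂ) (x : ℂ) : ℂ → ℂ :=
  fun φ => weight η a φ / (x - cos φ)

/-- The Stieltjes function `f(x)`. -/
def stieltjes (J : (ℂ → ℂ) → ℂ) (η : ℂ) (a : Fin 6 → ℂ) (x : ℂ) : ℂ :=
  J (stieltjesKernel η a x)

/-- The equation `W 𝔻f = 2 V 𝕄f + U` at all points `x = cos θ` with `θ ∈ S`. -/
def StieltjesEquation (η : ℂ) (a : Fin 6 → ℂ) (f : ℂ → ℂ) (S : Set ℂ) (U : ℂ[X]) : Prop :=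
  ∀ θ ∈ S, (specW η a).eval (cos θ) * awD η f θ =
    2 * (specV η a).eval (cos θ) * awM η f θ + U.eval (cos θ)

/-- The linear polynomial
`4 / (q² (q^(1/2) - q^(-1/2))) *
  [m_{0,0} (-2 q^(-1/2) (σ₆ - q²) x + σ₅ - q σ₁) - (σ₆ - q) (m_{0,+} + m_{0,-})]`. -/
def explicitU (J : (ℂ → ℂ) → ℂ) (η : ℂ) (a : Fin 6 → ℂ) : ℂ[X] :=
  C (4 / (base η ^ 2 * (baseHalf η - (baseHalf η)⁻¹))) *
    (C (moment00 J η a) *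
        (C (-2 * (baseHalf η)⁻¹ * (sigma a 6 - base η ^ 2)) * X
          + C (sigma a 5 - base η * sigma a 1))
      - C ((sigma a 6 - base η) * (momentPlus J η a + momentMinus J η a)))

/-- The defining property of the spectral data:
`W ± Δy V = z^(∓3) ∏_j (1 - a_j q^(-1/2) z^(±1))` (the lower sign is the case `-θ`). -/
theorem specW_add_deltaY_mul_specV (η : ℂ) (hη : 0 < η.im) (a : Fin 6 → ℂ) (θ : ℂ) :
    (specW η a).eval (cos θ) + deltaY η θ * (specV η a).eval (cos θ) =
      exp (I * θ) ^ (-3 : ℤ) * ∏ j, (1 - a j * (baseHalf η)⁻¹ * exp (I * θ)) := by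
  have hz : exp (I * θ) ≠ 0 := exp_ne_zero _
  have hh : baseHalf η ≠ 0 := exp_ne_zero _
  have hd : baseHalf η - (baseHalf η)⁻¹ ≠ 0 := by
    intro h
    have h2 : baseHalf η * baseHalf η = 1 := by
      have h3 := sub_eq_zero.mp h
      nth_rewrite 2 [h3]
      exact mul_inv_cancel₀ hh
    have hn : ‖baseHalf η‖ < 1 := by
      rw [baseHalf, Complex.norm_exp]
      simpa using hη
    have h4 : ‖baseHalf η‖ * ‖baseHalf η‖ = 1 := by rw [← norm_mul, h2, norm_one]
    nlinarith [norm_nonneg (baseHalf η)]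
  have hcos : cos θ = (exp (I * θ) + (exp (I * θ))⁻¹) / 2 := by
    rw [Complex.cos, ← Complex.exp_neg]; ring_nf
  have hdel : deltaY η θ =
      (baseHalf η - (baseHalf η)⁻¹) * (exp (I * θ) - (exp (I * θ))⁻¹) / 2 := by
    rw [deltaY, Complex.cos_add, Complex.cos_sub, baseHalf, ← Complex.exp_neg, ← Complex.exp_neg]
    have e1 : exp (I * η) = cos η + sin η * I := by rw [mul_comm, Complex.exp_mul_I]
    have e2 : exp (-(I * η)) = cos η - sin η * I := by
      rw [show -(I * η) = (-η) * I by ring, Complex.exp_mul_I, cos_neg, sin_neg]; ring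
    have e3 : exp (I * θ) = cos θ + sin θ * I := by rw [mul_comm, Complex.exp_mul_I]
    have e4 : exp (-(I * θ)) = cos θ - sin θ * I := by
      rw [show -(I * θ) = (-θ) * I by ring, Complex.exp_mul_I, cos_neg, sin_neg]; ring
    rw [e1, e2, e3, e4]
    linear_combination (-2 * sin θ * sin η) * Complex.I_mul_I
  have hprod : ∏ j, (1 - a j * (baseHalf η)⁻¹ * exp (I * θ)) =
      ∑ k ∈ Finset.range 7, (-exp (I * θ)) ^ k * sigmaTilde η a k := by
    have h1 : ∏ j, (1 - a j * (baseHalf η)⁻¹ * exp (I * θ)) =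
        ∏ j, (1 + (-exp (I * θ)) * ((baseHalf η)⁻¹ * a j)) :=
      Finset.prod_congr rfl fun j _ => by ring
    rw [h1, Finset.prod_one_add, Finset.sum_powerset]
    refine Finset.sum_congr (by simp) fun k _ => ?_
    rw [sigmaTilde, sigma, Finset.mul_sum]
    refine Finset.sum_congr rfl fun t ht => ?_
    rw [Finset.prod_mul_distrib, Finset.prod_const, (Finset.mem_powersetCard.mp ht).2]
  have h0 : sigmaTilde η a 0 = 1 := by simp [sigmaTilde, sigma]
  rw [hprod, hdel, hcos]
  generalize exp (I * θ) = z at *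
  simp only [specW, specV, Finset.sum_range_succ, Finset.sum_range_zero, eval_add, eval_sub,
    eval_mul, eval_C, eval_pow, eval_X, h0]
  have hc : (baseHalf η - (baseHalf η)⁻¹) * (1 / (baseHalf η - (baseHalf η)⁻¹)) = 1 := by
    rw [mul_one_div, div_self hd]
  generalize 1 / (baseHalf η - (baseHalf η)⁻¹) = c at *
  generalize baseHalf η - (baseHalf η)⁻¹ = d at *
  rw [show ∀ A B : ℂ, d * A / 2 * (c * B) = (d * c) * (A / 2 * B) from fun A B => by ring, hc]
  have hz3 : z ^ (-3 : ℤ) = (z ^ 3)⁻¹ := by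
    rw [zpow_neg]; rfl
  rw [hz3]
  field_simp
  ring

end

end QQuadratic

namespace QQuadratic

noncomputable section

open Filter Topology Asymptotics MeasureTheory

/-! ### The infinite `q`-Pochhammer symbol -/

/-! Write A(θ) = W + Δy V (`specA`), so that A(-θ) = W - Δy V. The factorisation of A into linear
factors makes w satisfy a Pearson equation, w(θ + 2η) A(-(θ + η)) = w(θ) A(θ + η): both sides are
the value at θ + η of one odd function `core` (`core_add`, `core_sub`).

At x = cos θ, W 𝔻f - 2V 𝕄f equals (A(-θ) f(y₊) - A(θ) f(y₋)) / Δy (`specW_mul_awD_sub`). Inserting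
the integral for f gives w(φ) integrated against a rational kernel. The algebraic heart is
`kernel_identity`: up to a difference in φ, this kernel is affine in x and cos φ. Multiplied by w,
the difference becomes G(φ + η) - G(φ - η) with G(φ) = `core`(φ) / (cos θ - cos φ). The affine part
integrates to the explicit polynomial, so the equation says exactly that the integral of the
difference vanishes. On the lattice it telescopes; on the contour it compares two translates of the
path, and Cauchy's theorem applies because G is holomorphic between them. `stieltjesEquation_iff`
makes this reduction for both integrals at once; uniqueness of U holds because the equation fixes U
at infinitely many x.

Convergence rests on `exists_weight_decay`: under θ ↦ θ + 2η the quantity w z⁻² is multiplied by a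
factor tending to q/σ₆ as z → 0, of modulus below 1. Every integrand is w times a function of at
most quadratic growth, and oddness of w carries the estimate to z → ∞. -/

theorem summable_norm_mul_pow {p : ℂ} (hp : ‖p‖ < 1) (c : ℂ) :
    Summable fun k : ℕ => ‖-(c * p ^ k)‖ := by
  simpa using (summable_geometric_of_lt_one (norm_nonneg p) hp).mul_left ‖c‖

theorem multipliable_one_sub_mul_pow {p : ℂ} (hp : ‖p‖ < 1) (c : ℂ) :
    Multipliable fun k : ℕ => 1 - c * p ^ k := by
  simpa [sub_eq_add_neg] using multipliable_one_add_of_summable (summable_norm_mul_pow hp c)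

theorem qPoch_eq_one_sub_mul {p : ℂ} (hp : ‖p‖ < 1) (c : ℂ) :
    qPoch c p = (1 - c) * qPoch (c * p) p := by
  have h := multipliable_one_sub_mul_pow hp (c * p)
  have e : (fun k : ℕ => 1 - c * p * p ^ k) = fun k : ℕ => 1 - c * p ^ (k + 1) := by
    funext k; rw [pow_succ']; ring
  rw [e] at h
  have h2 := tprod_eq_zero_mul' (f := fun k : ℕ => 1 - c * p ^ k) h
  rw [pow_zero, mul_one] at h2
  rw [qPoch, qPoch, e, h2]

theorem qPoch_ne_zero {p : ℂ} (hp : ‖p‖ < 1) {c : ℂ} (hc : ∀ k : ℕ, c * p ^ k ≠ 1) :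
    qPoch c p ≠ 0 := by
  simpa [qPoch, sub_eq_add_neg] using tprod_one_add_ne_zero_of_summable
    (f := fun k : ℕ => -(c * p ^ k))
    (fun k => by rw [← sub_eq_add_neg]; exact sub_ne_zero.mpr (hc k).symm)
    (summable_norm_mul_pow hp c)

theorem qPoch_one {p : ℂ} (hp : ‖p‖ < 1) : qPoch 1 p = 0 := by
  rw [qPoch_eq_one_sub_mul hp]; simp

/-- On the ball of radius ‖c‖ + 1 the factors are dominated by a geometric series, so the product
converges locally uniformly. -/
theorem differentiable_qPoch {p : ℂ} (hp : ‖p‖ < 1) : Differentiable ℂ fun c => qPoch c p := by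
  intro c
  have hs : Summable fun k : ℕ => (‖c‖ + 1) * ‖p‖ ^ k :=
    (summable_geometric_of_lt_one (norm_nonneg p) hp).mul_left _
  have h := (hs.hasProdLocallyUniformlyOn_nat_one_add (f := fun (k : ℕ) (c : ℂ) => -(c * p ^ k))
    (Metric.isOpen_ball (x := (0 : ℂ)) (ε := ‖c‖ + 1))
    (.of_forall fun k x hx => by
      rw [norm_neg, norm_mul, norm_pow]
      gcongr
      simpa using (Metric.mem_ball.mp hx).le)
    (fun k => by fun_prop)).differentiableOn
      (.of_forall fun _ => by
        simpa [Finset.prod_fn] using DifferentiableOn.finsetProd (fun _ _ => by fun_prop))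
      Metric.isOpen_ball
  have h2 := h.differentiableAt (x := c) (Metric.isOpen_ball.mem_nhds (by simp))
  simpa [qPoch, sub_eq_add_neg] using h2

@[fun_prop]
theorem DifferentiableAt.qPoch {p : ℂ} (hp : ‖p‖ < 1) {f : ℂ → ℂ} {x : ℂ}
    (hf : DifferentiableAt ℂ f x) : DifferentiableAt ℂ (fun y => QQuadratic.qPoch (f y) p) x :=
  (differentiable_qPoch hp (f x)).comp x hf

/-! ### The base -/

section Base

variable {η : ℂ}

theorem norm_exp_mul_I_lt_one (hη : 0 < η.im) {c : ℝ} (hc : 0 < c) :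
    ‖exp (c * I * η)‖ < 1 := by
  rw [Complex.norm_exp, Real.exp_lt_one_iff]
  simpa using mul_pos hc hη

theorem norm_base_lt_one (hη : 0 < η.im) : ‖base η‖ < 1 := by
  simpa [base] using norm_exp_mul_I_lt_one hη (c := 2) two_pos

theorem norm_exp_three_lt_one (hη : 0 < η.im) : ‖exp (3 * I * η)‖ < 1 := by
  simpa using norm_exp_mul_I_lt_one hη (c := 3) three_pos

theorem base_ne_zero : base η ≠ 0 := exp_ne_zero _

theorem baseHalf_ne_zero : baseHalf η ≠ 0 := exp_ne_zero _

theorem baseHalf_sq : baseHalf η ^ 2 = base η := by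
  rw [baseHalf, base, ← Complex.exp_nat_mul]; congr 1; push_cast; ring

theorem sin_ne_zero_of_im_ne_zero {θ : ℂ} (h : θ.im ≠ 0) : sin θ ≠ 0 := by
  intro h0
  obtain ⟨k, rfl⟩ := Complex.sin_eq_zero_iff.mp h0
  simp at h

theorem deltaY_eq (η θ : ℂ) : deltaY η θ = -2 * sin η * sin θ := by
  rw [deltaY, cos_add, cos_sub]; ring

end Base

/-! ### The weight -/

/-- The weight with the removable singularities at `z^3 = 1` cancelled. -/
theorem weight_eq {η : ℂ} (hη : 0 < η.im) (a : Fin 6 → ℂ) (θ : ℂ) :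
    weight η a θ = -2 * I * exp (3 * I * θ / 2) *
      (qPoch (exp (3 * I * θ) * exp (3 * I * η)) (exp (3 * I * η)) *
        qPoch (exp (-(3 * I * θ))) (exp (3 * I * η))) /
      ∏ j, (qPoch (a j * exp (I * θ)) (base η) * qPoch (a j * exp (-(I * θ))) (base η)) := by
  have hp := norm_exp_three_lt_one hη
  rw [weight, div_mul_eq_div_div, qPoch_eq_one_sub_mul hp (exp (3 * I * θ))]
  congr 1
  have e1 : exp (3 * I * θ) = exp (3 * I * θ / 2) ^ 2 := by
    rw [← Complex.exp_nat_mul]; congr 1; push_cast; ring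
  have hs : sin (3 * θ / 2) * (2 * I * exp (3 * I * θ / 2)) = exp (3 * I * θ) - 1 := by
    rw [sin, e1]
    have : exp (-(3 * θ / 2) * I) = (exp (3 * I * θ / 2))⁻¹ := by
      rw [← Complex.exp_neg]; congr 1; ring
    rw [this, show 3 * θ / 2 * I = 3 * I * θ / 2 by ring]
    have := exp_ne_zero (3 * I * θ / 2)
    field_simp
    linear_combination (1 - exp (3 * I * θ / 2) ^ 2) * I_sq
  -- At a zero of the sine the quotient is `0` by the division convention. This is also its limit,
  -- since the numerator has a double zero there.
  by_cases h0 : sin (3 * θ / 2) = 0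
  · have h1 : exp (3 * I * θ) = 1 := by
      rw [h0, zero_mul] at hs; exact (sub_eq_zero.mp hs.symm)
    have h2 : exp (-(3 * I * θ)) = 1 := by rw [Complex.exp_neg, h1, inv_one]
    rw [h2, qPoch_one hp]; simp
  · rw [div_eq_iff h0]
    linear_combination ((qPoch (exp (3 * I * θ) * exp (3 * I * η)) (exp (3 * I * η)) *
        qPoch (exp (-(3 * I * θ))) (exp (3 * I * η)))) * hs

theorem weight_neg (η : ℂ) (a : Fin 6 → ℂ) (θ : ℂ) : weight η a (-θ) = -weight η a θ := by
  rw [weight, weight, show 3 * -θ / 2 = -(3 * θ / 2) by ring, sin_neg, neg_mul, div_neg,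
    mul_neg, mul_neg, neg_neg, neg_neg, mul_comm (qPoch (exp (3 * I * θ)) _)]
  congr 3
  exact Finset.prod_congr rfl fun j _ => mul_comm _ _

/-- `W + Δy V` at `θ`. -/
def specA (η : ℂ) (a : Fin 6 → ℂ) (θ : ℂ) : ℂ :=
  exp (-(3 * I * θ)) * ∏ j, (1 - a j * (baseHalf η)⁻¹ * exp (I * θ))

theorem specA_eq {η : ℂ} (hη : 0 < η.im) (a : Fin 6 → ℂ) (θ : ℂ) :
    specA η a θ = (specW η a).eval (cos θ) + deltaY η θ * (specV η a).eval (cos θ) := by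
  rw [specW_add_deltaY_mul_specV η hη, specA, ← Complex.exp_int_mul]
  congr 2
  push_cast; ring

/-- The function `w(θ - η) (W + Δy V)(θ)`, with the removable singularities cancelled. -/
def core (η : ℂ) (a : Fin 6 → ℂ) (θ : ℂ) : ℂ :=
  -2 * I * exp (-(3 * I * η / 2)) * exp (-(3 * I * θ / 2)) *
    (qPoch (exp (3 * I * θ)) (exp (3 * I * η)) *
      qPoch (exp (-(3 * I * θ)) * exp (3 * I * η)) (exp (3 * I * η))) /
    ∏ j, (qPoch (a j * baseHalf η * exp (I * θ)) (base η) *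
      qPoch (a j * baseHalf η * exp (-(I * θ))) (base η))

/-- The two sides differ only in which symbol carries its leading factor; the prefactor turns 1 - z³
into z^(-3/2) - z^(3/2), which is odd. -/
theorem core_neg {η : ℂ} (hη : 0 < η.im) (a : Fin 6 → ℂ) (θ : ℂ) :
    core η a (-θ) = -core η a θ := by
  have hp := norm_exp_three_lt_one hη
  simp only [core, mul_neg, neg_neg, neg_div]
  rw [qPoch_eq_one_sub_mul hp (exp (-(3 * I * θ))), qPoch_eq_one_sub_mul hp (exp (3 * I * θ)),
    ← neg_div, Finset.prod_congr rfl fun j _ => mul_comm (qPoch (a j * _ * exp (-(I * θ))) _) _]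
  have e1 : exp (3 * I * θ) = exp (3 * I * θ / 2) ^ 2 := by
    rw [← Complex.exp_nat_mul]; congr 1; push_cast; ring
  rw [Complex.exp_neg (3 * I * θ / 2), Complex.exp_neg (3 * I * θ), e1]
  have := exp_ne_zero (3 * I * θ / 2)
  generalize Finset.prod (Finset.univ : Finset (Fin 6)) (_ : Fin 6 → ℂ) = D
  field_simp
  ring

/-- The symbols in `core` at θ + η lack exactly the leading factors 1 - a_j z, and these are what
`specA` supplies. The hypothesis keeps them nonzero so that they cancel. -/
theorem core_add {η : ℂ} (hη : 0 < η.im) (a : Fin 6 → ℂ) {θ : ℂ}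
    (h : ∀ j, a j * exp (I * θ) ≠ 1) :
    core η a (θ + η) = weight η a θ * specA η a (θ + η) := by
  have hq := norm_base_lt_one hη
  have hh := baseHalf_ne_zero (η := η)
  rw [weight_eq hη, core, specA]
  have e1 : ∀ j, a j * baseHalf η * exp (I * (θ + η)) = a j * exp (I * θ) * base η := fun j => by
    rw [← baseHalf_sq, mul_add, Complex.exp_add, ← baseHalf.eq_1 η]; ring
  have e2 : ∀ j, a j * baseHalf η * exp (-(I * (θ + η))) = a j * exp (-(I * θ)) := fun j => by
    rw [mul_add, neg_add, Complex.exp_add, Complex.exp_neg (I * η), ← baseHalf.eq_1 η]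
    field_simp
  have e3 : ∀ j, a j * (baseHalf η)⁻¹ * exp (I * (θ + η)) = a j * exp (I * θ) := fun j => by
    rw [mul_add, Complex.exp_add, ← baseHalf.eq_1 η]
    field_simp
  have e4 : exp (3 * I * (θ + η)) = exp (3 * I * θ) * exp (3 * I * η) := by
    rw [← Complex.exp_add]; ring_nf
  have e5 : exp (-(3 * I * (θ + η))) * exp (3 * I * η) = exp (-(3 * I * θ)) := by
    rw [← Complex.exp_add]; ring_nf
  have e6 : exp (-(3 * I * η / 2)) * exp (-(3 * I * (θ + η) / 2)) =
      exp (3 * I * θ / 2) * exp (-(3 * I * (θ + η))) := by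
    rw [← Complex.exp_add, ← Complex.exp_add]; ring_nf
  simp only [e1, e2, e3, e4, e5]
  have e7 : ∀ j, qPoch (a j * exp (I * θ)) (base η) =
      (1 - a j * exp (I * θ)) * qPoch (a j * exp (I * θ) * base η) (base η) :=
    fun j => qPoch_eq_one_sub_mul hq _
  have e8 : ∏ j, (qPoch (a j * exp (I * θ)) (base η) * qPoch (a j * exp (-(I * θ))) (base η)) =
      ∏ j, ((1 - a j * exp (I * θ)) * (qPoch (a j * exp (I * θ) * base η) (base η) *
        qPoch (a j * exp (-(I * θ))) (base η))) :=
    Finset.prod_congr rfl fun j _ => by rw [e7, mul_assoc]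
  rw [e8, Finset.prod_mul_distrib (f := fun j => 1 - a j * exp (I * θ))]
  have hne : ∏ j, (1 - a j * exp (I * θ)) ≠ 0 :=
    Finset.prod_ne_zero_iff.mpr fun j _ => sub_ne_zero.mpr (h j).symm
  rw [mul_assoc (-2 * I), e6]
  generalize ∏ j, (1 - a j * exp (I * θ)) = A at *
  generalize Finset.prod (Finset.univ : Finset (Fin 6)) (_ : Fin 6 → ℂ) = D
  field_simp

/-- The reflection of `core_add`: `core` and `weight` are both odd. -/
theorem core_sub {η : ℂ} (hη : 0 < η.im) (a : Fin 6 → ℂ) {θ : ℂ}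
    (h : ∀ j, a j * exp (-(I * θ)) ≠ 1) :
    core η a (θ - η) = weight η a θ * specA η a (η - θ) := by
  rw [show θ - η = -(-θ + η) by ring, core_neg hη, core_add hη a (by simpa using h), weight_neg,
    show -θ + η = η - θ by ring]
  ring

/-! ### Elementary symmetric functions -/

theorem prod_one_sub_mul_eq_sum_sigma (a : Fin 6 → ℂ) (z : ℂ) :
    ∏ j, (1 - a j * z) = ∑ k ∈ Finset.range 7, (-z) ^ k * sigma a k := by
  have h1 : ∏ j, (1 - a j * z) = ∏ j, (1 + (-z) * a j) :=
    Finset.prod_congr rfl fun j _ => by ring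
  rw [h1, Finset.prod_one_add, Finset.sum_powerset]
  refine Finset.sum_congr (by simp) fun k _ => ?_
  rw [sigma, Finset.mul_sum]
  refine Finset.sum_congr rfl fun t ht => ?_
  rw [Finset.prod_mul_distrib, Finset.prod_const, (Finset.mem_powersetCard.mp ht).2]

theorem sigma_zero (a : Fin 6 → ℂ) : sigma a 0 = 1 := by simp [sigma]

theorem sigma_six (a : Fin 6 → ℂ) : sigma a 6 = ∏ j, a j := by
  have : (Finset.univ : Finset (Fin 6)).powersetCard 6 = {Finset.univ} := by
    simpa using Finset.powersetCard_self (Finset.univ : Finset (Fin 6))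
  rw [sigma, this, Finset.sum_singleton]

/-! ### The kernel identity -/

/-- This is `kernel_identity` with the cosine differences cleared from the denominators, where h =
q^(1/2), z = e^(iθ), w = e^(iφ) and s k = σ_k. -/
theorem kernel_identity_laurent {h z w : ℂ} (hh : h ≠ 0) (hz : z ≠ 0) (hw : w ≠ 0)
    (hd : h ^ 2 - 1 ≠ 0) (hz2 : z ^ 2 - 1 ≠ 0) (s : ℕ → ℂ) (hs : s 0 = 1) :
    (h - h⁻¹) * (w - w⁻¹) / 2 * (
      (z ^ 3 * ∑ k ∈ Finset.range 7, (-(h⁻¹ * z⁻¹)) ^ k * s k) *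
          ((h⁻¹ * z + h * z⁻¹) / 2 - (w + w⁻¹) / 2)
        - (z⁻¹ ^ 3 * ∑ k ∈ Finset.range 7, (-(h⁻¹ * z)) ^ k * s k) *
          ((h * z + h⁻¹ * z⁻¹) / 2 - (w + w⁻¹) / 2)) / ((h - h⁻¹) * (z - z⁻¹) / 2) =
    -((h⁻¹ ^ 3 * w⁻¹ ^ 3 * ∑ k ∈ Finset.range 7, (-w) ^ k * s k) *
          ((z + z⁻¹) / 2 - (h⁻¹ * w + h * w⁻¹) / 2)
        - (h⁻¹ ^ 3 * w ^ 3 * ∑ k ∈ Finset.range 7, (-w⁻¹) ^ k * s k) *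
          ((z + z⁻¹) / 2 - (h * w + h⁻¹ * w⁻¹) / 2)) +
    (h - h⁻¹) * (w - w⁻¹) / 2 *
      (4 / (h ^ 4 * (h - h⁻¹)) * (-2 * h⁻¹ * (s 6 - h ^ 4) * ((z + z⁻¹) / 2) + (s 5 - h ^ 2 * s 1)
        - (s 6 - h ^ 2) * (w + w⁻¹))) *
      (((h * z + h⁻¹ * z⁻¹) / 2 - (w + w⁻¹) / 2) * ((h⁻¹ * z + h * z⁻¹) / 2 - (w + w⁻¹) / 2)) := by
  -- Exposes h² - 1 and z² - 1 as the only denominators that are not monomials, to match `hd` and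
  -- `hz2`.
  have e1 : h - h⁻¹ = (h ^ 2 - 1) / h := by field_simp
  have e2 : z - z⁻¹ = (z ^ 2 - 1) / z := by field_simp
  simp only [Finset.sum_range_succ, Finset.sum_range_zero, hs]
  generalize s 1 = s1
  generalize s 2 = s2
  generalize s 3 = s3
  generalize s 4 = s4
  generalize s 5 = s5
  generalize s 6 = s6
  rw [e1, e2]
  field_simp
  ring


theorem cos_eq_exp (θ : ℂ) : cos θ = (exp (I * θ) + (exp (I * θ))⁻¹) / 2 := by
  rw [Complex.cos, ← Complex.exp_neg]; ring_nf

theorem cos_add_eq (η θ : ℂ) :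
    cos (θ + η) = (baseHalf η * exp (I * θ) + (baseHalf η)⁻¹ * (exp (I * θ))⁻¹) / 2 := by
  rw [cos_eq_exp, mul_add, Complex.exp_add, ← baseHalf.eq_1 η, mul_inv]; ring

theorem cos_sub_eq (η θ : ℂ) :
    cos (θ - η) = ((baseHalf η)⁻¹ * exp (I * θ) + baseHalf η * (exp (I * θ))⁻¹) / 2 := by
  rw [cos_eq_exp, mul_sub, Complex.exp_sub, ← baseHalf.eq_1 η, inv_div]; ring

theorem deltaY_eq_exp (η θ : ℂ) :
    deltaY η θ = (baseHalf η - (baseHalf η)⁻¹) * (exp (I * θ) - (exp (I * θ))⁻¹) / 2 := by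
  rw [deltaY, cos_add_eq, cos_sub_eq]; ring

/-- Both sides equal cos²θ + cos²φ - 2 cos θ cos φ cos η - sin²η, which is symmetric in θ and φ.
Hence the fractions shifted in θ and those shifted in φ have a common denominator. -/
theorem cos_sub_cos_mul (η θ φ : ℂ) :
    (cos θ - cos (φ + η)) * (cos θ - cos (φ - η)) =
      (cos (θ + η) - cos φ) * (cos (θ - η) - cos φ) := by
  have h1 := sin_sq_add_cos_sq θ
  have h2 := sin_sq_add_cos_sq φ
  have h3 := sin_sq_add_cos_sq η
  rw [cos_add, cos_add, cos_sub, cos_sub]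
  linear_combination (-sin η ^ 2) * h2 + sin η ^ 2 * h1 + (cos φ ^ 2 - cos θ ^ 2) * h3

theorem exp_neg_three_mul (θ : ℂ) : exp (-(3 * I * θ)) = (exp (I * θ))⁻¹ ^ 3 := by
  rw [← Complex.exp_neg, ← Complex.exp_nat_mul]; congr 1; push_cast; ring

theorem specA_eq_sum (η : ℂ) (a : Fin 6 → ℂ) (θ : ℂ) :
    specA η a θ = (exp (I * θ))⁻¹ ^ 3 *
      ∑ k ∈ Finset.range 7, (-((baseHalf η)⁻¹ * exp (I * θ))) ^ k * sigma a k := by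
  rw [specA, exp_neg_three_mul, ← prod_one_sub_mul_eq_sum_sigma]
  simp only [mul_assoc]

theorem baseHalf_sq_sub_one_ne_zero {η : ℂ} (hη : 0 < η.im) : baseHalf η ^ 2 - 1 ≠ 0 := by
  intro h
  have h1 := norm_base_lt_one hη
  rw [← baseHalf_sq, sub_eq_zero.mp h, norm_one] at h1
  exact lt_irrefl _ h1

theorem exp_sq_sub_one_ne_zero {θ : ℂ} (hθ : sin θ ≠ 0) : exp (I * θ) ^ 2 - 1 ≠ 0 := by
  contrapose! hθ
  have h1 : exp (-θ * I) = (exp (I * θ))⁻¹ := by rw [← Complex.exp_neg]; ring_nf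
  rw [sin, h1, mul_comm θ I]
  have := exp_ne_zero (I * θ)
  field_simp
  linear_combination (-I) * hθ

theorem deltaY_ne_zero {η θ : ℂ} (hη : 0 < η.im) (hθ : sin θ ≠ 0) : deltaY η θ ≠ 0 := by
  rw [deltaY_eq]
  exact mul_ne_zero (mul_ne_zero (by norm_num) (sin_ne_zero_of_im_ne_zero hη.ne')) hθ

/-- The linear function of `x` and `2 cos φ` that is integrated against `w` in `explicitU`. -/
def linearKernel (η : ℂ) (a : Fin 6 → ℂ) (x φ : ℂ) : ℂ :=
  4 / (base η ^ 2 * (baseHalf η - (baseHalf η)⁻¹)) *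
    (-2 * (baseHalf η)⁻¹ * (sigma a 6 - base η ^ 2) * x + (sigma a 5 - base η * sigma a 1)
      - (sigma a 6 - base η) * (exp (I * φ) + exp (-(I * φ))))

theorem kernel_identity {η : ℂ} (hη : 0 < η.im) (a : Fin 6 → ℂ) {θ φ : ℂ} (hθ : sin θ ≠ 0)
    (h1 : cos (θ + η) ≠ cos φ) (h2 : cos (θ - η) ≠ cos φ) :
    deltaY η φ * ((specA η a (-θ) / (cos (θ + η) - cos φ) -
        specA η a θ / (cos (θ - η) - cos φ)) / deltaY η θ) =
      -(specA η a (φ + η) / (cos θ - cos (φ + η)) - specA η a (η - φ) / (cos θ - cos (φ - η)))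
        + deltaY η φ * linearKernel η a (cos θ) φ := by
  have hm := cos_sub_cos_mul η θ φ
  have k1 := sub_ne_zero.mpr h1
  have k2 := sub_ne_zero.mpr h2
  have k12 := mul_ne_zero k1 k2
  have k3 : cos θ - cos (φ + η) ≠ 0 := left_ne_zero_of_mul (hm ▸ k12)
  have k4 : cos θ - cos (φ - η) ≠ 0 := right_ne_zero_of_mul (hm ▸ k12)
  have kd := deltaY_ne_zero hη hθ
  have key := kernel_identity_laurent (baseHalf_ne_zero (η := η)) (exp_ne_zero (I * θ))
    (exp_ne_zero (I * φ)) (baseHalf_sq_sub_one_ne_zero hη) (exp_sq_sub_one_ne_zero hθ)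
    (sigma a) (sigma_zero a)
  have a1 : specA η a (-θ) = exp (I * θ) ^ 3 *
      ∑ k ∈ Finset.range 7, (-((baseHalf η)⁻¹ * (exp (I * θ))⁻¹)) ^ k * sigma a k := by
    rw [specA_eq_sum, mul_neg, Complex.exp_neg, inv_inv]
  have a2 : specA η a (φ + η) = (baseHalf η)⁻¹ ^ 3 * (exp (I * φ))⁻¹ ^ 3 *
      ∑ k ∈ Finset.range 7, (-exp (I * φ)) ^ k * sigma a k := by
    have e : (baseHalf η)⁻¹ * exp (I * (φ + η)) = exp (I * φ) := by
      rw [mul_add, Complex.exp_add, ← baseHalf.eq_1 η]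
      field_simp [baseHalf_ne_zero (η := η)]
    rw [specA_eq_sum, e, mul_add, Complex.exp_add, ← baseHalf.eq_1 η]
    ring
  have a3 : specA η a (η - φ) = (baseHalf η)⁻¹ ^ 3 * exp (I * φ) ^ 3 *
      ∑ k ∈ Finset.range 7, (-(exp (I * φ))⁻¹) ^ k * sigma a k := by
    have e : (baseHalf η)⁻¹ * exp (I * (η - φ)) = (exp (I * φ))⁻¹ := by
      rw [mul_sub, Complex.exp_sub, ← baseHalf.eq_1 η]
      field_simp [baseHalf_ne_zero (η := η)]
    rw [specA_eq_sum, e, mul_sub, Complex.exp_sub, ← baseHalf.eq_1 η, inv_div]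
    ring
  have b4 : baseHalf η ^ 4 = base η ^ 2 := by rw [← baseHalf_sq]; ring
  rw [← a1, ← specA_eq_sum, ← a2, ← a3, ← cos_add_eq, ← cos_sub_eq, ← cos_eq_exp, ← cos_eq_exp,
    ← cos_add_eq, ← cos_sub_eq, ← deltaY_eq_exp, ← deltaY_eq_exp, b4, baseHalf_sq,
    ← Complex.exp_neg] at key
  have e1 : deltaY η φ * ((specA η a (-θ) / (cos (θ + η) - cos φ) -
        specA η a θ / (cos (θ - η) - cos φ)) / deltaY η θ) =
      deltaY η φ * (specA η a (-θ) * (cos (θ - η) - cos φ) -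
        specA η a θ * (cos (θ + η) - cos φ)) / deltaY η θ /
          ((cos (θ + η) - cos φ) * (cos (θ - η) - cos φ)) := by
    field_simp
  have e2 : specA η a (φ + η) / (cos θ - cos (φ + η)) - specA η a (η - φ) / (cos θ - cos (φ - η)) =
      (specA η a (φ + η) * (cos θ - cos (φ - η)) - specA η a (η - φ) * (cos θ - cos (φ + η))) /
        ((cos (θ + η) - cos φ) * (cos (θ - η) - cos φ)) := by
    rw [← hm]; field_simp
  rw [e1, e2, key, linearKernel]
  generalize specA η a (φ + η) * (cos θ - cos (φ - η)) -
    specA η a (η - φ) * (cos θ - cos (φ + η)) = X1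
  generalize 4 / (base η ^ 2 * (baseHalf η - (baseHalf η)⁻¹)) = X2
  field_simp

/-! ### The equation for an abstract integral -/

/-- The integrand whose vanishing integral expresses the equation at `θ`. -/
def defect (η : ℂ) (a : Fin 6 → ℂ) (θ φ : ℂ) : ℂ :=
  weight η a φ * (linearKernel η a (cos θ) φ -
    (specA η a (-θ) / (cos (θ + η) - cos φ) - specA η a θ / (cos (θ - η) - cos φ)) / deltaY η θ)

theorem deltaY_mul_defect {η : ℂ} (hη : 0 < η.im) (a : Fin 6 → ℂ) {θ φ : ℂ} (hθ : sin θ ≠ 0)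
    (h1 : cos (θ + η) ≠ cos φ) (h2 : cos (θ - η) ≠ cos φ)
    (h3 : ∀ j, a j * exp (I * φ) ≠ 1) (h4 : ∀ j, a j * exp (-(I * φ)) ≠ 1) :
    deltaY η φ * defect η a θ φ =
      core η a (φ + η) / (cos θ - cos (φ + η)) - core η a (φ - η) / (cos θ - cos (φ - η)) := by
  rw [core_add hη a h3, core_sub hη a h4, defect]
  linear_combination (-weight η a φ) * kernel_identity hη a hθ h1 h2

theorem specW_mul_awD_sub {η : ℂ} (hη : 0 < η.im) (a : Fin 6 → ℂ) (f : ℂ → ℂ) {θ : ℂ}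
    (hθ : sin θ ≠ 0) :
    (specW η a).eval (cos θ) * awD η f θ - 2 * (specV η a).eval (cos θ) * awM η f θ =
      (specA η a (-θ) * f (cos (θ + η)) - specA η a θ * f (cos (θ - η))) / deltaY η θ := by
  have kd := deltaY_ne_zero hη hθ
  have kn : deltaY η (-θ) = -deltaY η θ := by rw [deltaY_eq, deltaY_eq, sin_neg]; ring
  rw [specA_eq hη, specA_eq hη, kn, cos_neg, awD, awM]
  field_simp
  ring

theorem explicitU_eval (J : (ℂ → ℂ) → ℂ) (η : ℂ) (a : Fin 6 → ℂ) (x : ℂ) :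
    (explicitU J η a).eval x = 4 / (base η ^ 2 * (baseHalf η - (baseHalf η)⁻¹)) *
      (moment00 J η a * (-2 * (baseHalf η)⁻¹ * (sigma a 6 - base η ^ 2) * x +
        (sigma a 5 - base η * sigma a 1)) -
        (sigma a 6 - base η) * (momentPlus J η a + momentMinus J η a)) := by
  simp only [explicitU, eval_mul, eval_C, eval_sub, eval_add, eval_X]

/-- The integral enters only through linearity; what is specific to a support is confined to the
integrability hypotheses and to `hD`. -/
theorem stieltjesEquation_iff {η : ℂ} (hη : 0 < η.im) (a : Fin 6 → ℂ) {J : (ℂ → ℂ) → ℂ}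
    {Jint : (ℂ → ℂ) → Prop}
    (hJ : ∀ (F G : ℂ → ℂ) (c : ℂ), Jint F → Jint G →
      Jint (fun φ => F φ + c * G φ) ∧ J (fun φ => F φ + c * G φ) = J F + c * J G)
    {S : Set ℂ} (hS : (cos '' S).Infinite)
    (h0 : Jint (weight η a)) (hp : Jint fun φ => weight η a φ * exp (I * φ))
    (hm : Jint fun φ => weight η a φ * exp (-(I * φ)))
    (hsin : ∀ θ ∈ S, sin θ ≠ 0)
    (hK : ∀ θ ∈ S, Jint (stieltjesKernel η a (cos (θ + η))) ∧
      Jint (stieltjesKernel η a (cos (θ - η))))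
    (hD : ∀ θ ∈ S, J (defect η a θ) = 0) (U : ℂ[X]) :
    StieltjesEquation η a (stieltjes J η a) S U ↔ U = explicitU J η a := by
  have main : StieltjesEquation η a (stieltjes J η a) S (explicitU J η a) := by
    intro θ hθ
    rw [← sub_eq_iff_eq_add', specW_mul_awD_sub hη a _ (hsin θ hθ), explicitU_eval]
    obtain ⟨k1, k2⟩ := hK θ hθ
    set c := 4 / (base η ^ 2 * (baseHalf η - (baseHalf η)⁻¹)) with hc
    set c0 := -2 * (baseHalf η)⁻¹ * (sigma a 6 - base η ^ 2) * cos θ +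
        (sigma a 5 - base η * sigma a 1) with hc0
    set c1 := sigma a 6 - base η with hc1
    -- `hJ` only forms `F + c * G`, so the multiple c c0 of w is written as w + (c c0 - 1) w.
    have s0 := hJ _ _ (c * c0 - 1) h0 h0
    have s1 := hJ _ _ (-(c * c1)) s0.1 hp
    have s2 := hJ _ _ (-(c * c1)) s1.1 hm
    have s3 := hJ _ _ (-(specA η a (-θ) / deltaY η θ)) s2.1 k1
    have s4 := hJ _ _ (specA η a θ / deltaY η θ) s3.1 k2
    have e : defect η a θ = fun φ => weight η a φ + (c * c0 - 1) * weight η a φ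
        + -(c * c1) * (weight η a φ * exp (I * φ)) + -(c * c1) * (weight η a φ * exp (-(I * φ)))
        + -(specA η a (-θ) / deltaY η θ) * stieltjesKernel η a (cos (θ + η)) φ
        + (specA η a θ / deltaY η θ) * stieltjesKernel η a (cos (θ - η)) φ := by
      funext φ
      rw [defect, linearKernel, ← hc, ← hc0, ← hc1, stieltjesKernel, stieltjesKernel]
      ring
    have h := hD θ hθ
    rw [e, s4.2, s3.2, s2.2, s1.2, s0.2] at h
    rw [moment00, momentPlus, momentMinus, stieltjes, stieltjes]
    linear_combination (-1 : ℂ) * h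
  refine ⟨fun h => ?_, fun h => h ▸ main⟩
  refine Polynomial.eq_of_infinite_eval_eq _ _ (hS.mono ?_)
  rintro _ ⟨θ, hθ, rfl⟩
  exact add_left_cancel ((h θ hθ).symm.trans (main θ hθ))

/-! ### Growth as `z → 0` and `z → ∞` -/

/-- The filter of angles with `Im θ → ∞`, that is `z → 0`. -/
def up : Filter ℂ := comap im atTop

theorem tendsto_exp_up : Tendsto (fun θ => exp (I * θ)) up (𝓝 0) := by
  refine tendsto_exp_comap_re_atBot.comp (tendsto_comap_iff.mpr ?_)
  have : Tendsto (fun θ : ℂ => -θ.im) up atBot := tendsto_neg_atTop_atBot.comp tendsto_comap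
  refine this.congr fun θ => by simp

theorem tendsto_add_const_up (c : ℂ) : Tendsto (fun θ => θ + c) up up := by
  refine tendsto_comap_iff.mpr ?_
  exact (tendsto_atTop_add_const_right _ c.im tendsto_comap).congr fun θ => by simp

/-- Functions that grow at most like `z⁻²` as `z → 0` and like `z²` as `z → ∞`. -/
def QuadGrowth (h : ℂ → ℂ) : Prop :=
  h =O[up] (fun θ => exp (-(I * θ)) ^ 2) ∧ (fun θ => h (-θ)) =O[up] fun θ => exp (-(I * θ)) ^ 2

theorem QuadGrowth.comp_neg {h : ℂ → ℂ} (hh : QuadGrowth h) : QuadGrowth fun θ => h (-θ) :=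
  ⟨hh.2, by simpa using hh.1⟩

theorem isBigO_exp_one : (fun θ => exp (I * θ)) =O[up] fun _ => (1 : ℂ) :=
  tendsto_exp_up.isBigO_one ℂ

theorem isBigO_one_exp_neg : (fun _ => (1 : ℂ)) =O[up] fun θ => exp (-(I * θ)) :=
  (isBigO_exp_one.mul (isBigO_refl (fun θ => exp (-(I * θ))) up)).congr
    (fun θ => by rw [← Complex.exp_add]; simp) fun θ => one_mul _

theorem isBigO_exp_exp_neg : (fun θ => exp (I * θ)) =O[up] fun θ => exp (-(I * θ)) :=
  isBigO_exp_one.trans isBigO_one_exp_neg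

theorem isBigO_sin : sin =O[up] fun θ => exp (-(I * θ)) := by
  have := ((isBigO_refl (fun θ => exp (-(I * θ))) up).sub isBigO_exp_exp_neg).const_mul_left (I / 2)
  refine this.congr_left fun θ => ?_
  rw [sin]; ring_nf

theorem tendsto_sub_cos_mul_exp (x c : ℂ) :
    Tendsto (fun θ => (x - cos (θ + c)) * exp (I * θ)) up (𝓝 (-(exp (-(I * c)) / 2))) := by
  have h1 : Tendsto (fun θ => x * exp (I * θ) - exp (I * c) / 2 * exp (I * θ) ^ 2
      - exp (-(I * c)) / 2) up (𝓝 (x * 0 - exp (I * c) / 2 * 0 ^ 2 - exp (-(I * c)) / 2)) :=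
    ((tendsto_exp_up.const_mul x).sub ((tendsto_exp_up.pow 2).const_mul _)).sub_const _
  simp only [mul_zero, ne_eq, OfNat.ofNat_ne_zero, not_false_eq_true, zero_pow, sub_zero,
    zero_sub] at h1
  refine h1.congr fun θ => ?_
  rw [cos_eq_exp, mul_add, Complex.exp_add, Complex.exp_neg]
  field_simp [exp_ne_zero (I * θ), exp_ne_zero (I * c)]
  ring

theorem isBigO_inv_sub_cos (x c : ℂ) :
    (fun θ => (x - cos (θ + c))⁻¹) =O[up] fun θ => exp (I * θ) := by
  have hne : -(exp (-(I * c)) / 2) ≠ 0 := by simp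
  have h := (((tendsto_sub_cos_mul_exp x c).inv₀ hne).isBigO_one ℂ).mul
    (isBigO_refl (fun θ => exp (I * θ)) up)
  refine h.congr (fun θ => ?_) fun θ => one_mul _
  rw [mul_inv, mul_assoc, inv_mul_cancel₀ (exp_ne_zero _), mul_one]

theorem isBigO_inv_sub_cos_neg (x c : ℂ) :
    (fun θ => (x - cos (-θ + c))⁻¹) =O[up] fun θ => exp (I * θ) := by
  refine (isBigO_inv_sub_cos x (-c)).congr_left fun θ => ?_
  rw [← cos_neg, neg_add, neg_neg]

theorem isBigO_exp_neg_three (θ₀ : ℂ) :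
    (fun θ => exp (-(3 * I * (θ + θ₀)))) =O[up] fun θ => exp (-(I * θ)) ^ 3 := by
  refine ((isBigO_refl (fun θ => exp (-(I * θ)) ^ 3) up).const_mul_left
    (exp (-(3 * I * θ₀)))).congr_left fun θ => ?_
  rw [← Complex.exp_nat_mul, ← Complex.exp_add]
  congr 1; push_cast; ring

theorem isBigO_specA_add (η : ℂ) (a : Fin 6 → ℂ) (c : ℂ) :
    (fun θ => specA η a (θ + c)) =O[up] fun θ => exp (-(I * θ)) ^ 3 := by
  have h1 : (fun θ => ∏ j, (1 - a j * (baseHalf η)⁻¹ * exp (I * (θ + c)))) =O[up]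
      fun _ => (1 : ℂ) := by
    have := tendsto_finsetProd (Finset.univ : Finset (Fin 6)) fun j _ =>
      ((tendsto_exp_up.comp (tendsto_add_const_up c)).const_mul
        (a j * (baseHalf η)⁻¹)).const_sub (1 : ℂ)
    exact this.isBigO_one ℂ
  simpa [specA] using (isBigO_exp_neg_three c).mul h1

/-- `specA` is z⁻³ times a polynomial of degree at most 6 in z, so at z → ∞ it grows at most like
z³: six parameters balance the exponent 3. -/
theorem isBigO_specA_neg_add (η : ℂ) (a : Fin 6 → ℂ) (c : ℂ) :
    (fun θ => specA η a (-θ + c)) =O[up] fun θ => exp (-(I * θ)) ^ 3 := by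
  have h1 : (fun θ => ∏ j, (exp (I * θ) - a j * (baseHalf η)⁻¹ * exp (I * c))) =O[up]
      fun _ => (1 : ℂ) := by
    have := tendsto_finsetProd (Finset.univ : Finset (Fin 6)) fun j _ =>
      tendsto_exp_up.sub_const (a j * (baseHalf η)⁻¹ * exp (I * c))
    exact this.isBigO_one ℂ
  have h2 := ((isBigO_refl (fun θ => exp (-(I * θ)) ^ 3) up).mul h1).const_mul_left
    (exp (-(3 * I * c)))
  simp only [mul_one] at h2
  refine h2.congr_left fun θ => ?_
  have e : ∀ j, 1 - a j * (baseHalf η)⁻¹ * exp (I * (-θ + c)) =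
      exp (-(I * θ)) * (exp (I * θ) - a j * (baseHalf η)⁻¹ * exp (I * c)) := fun j => by
    rw [mul_sub, ← Complex.exp_add, mul_add, Complex.exp_add, mul_neg]
    simp; ring
  rw [specA, Finset.prod_congr rfl fun j _ => e j, Finset.prod_mul_distrib, Finset.prod_const,
    show -(3 * I * (-θ + c)) = -(3 * I * c) + 3 * (I * θ) by ring, Complex.exp_add]
  have e3 : exp (3 * (I * θ)) * exp (-(I * θ)) ^ 6 = exp (-(I * θ)) ^ 3 := by
    rw [← Complex.exp_nat_mul, ← Complex.exp_nat_mul, ← Complex.exp_add]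
    congr 1; push_cast; ring
  simp only [Finset.card_univ, Fintype.card_fin]
  rw [← e3]; ring

theorem quadGrowth_sin : QuadGrowth sin := by
  have h : sin =O[up] fun θ => exp (-(I * θ)) ^ 2 :=
    (isBigO_sin.mul isBigO_one_exp_neg).congr (fun θ => mul_one _) fun θ => (sq _).symm
  exact ⟨h, by simpa using h.neg_left⟩

theorem quadGrowth_exp_mul_sin : QuadGrowth fun θ => exp (I * θ) * sin θ := by
  refine ⟨(isBigO_exp_exp_neg.mul isBigO_sin).congr_right fun θ => (sq _).symm, ?_⟩
  refine (((isBigO_refl (fun θ => exp (-(I * θ))) up).mul isBigO_sin).neg_left).congr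
    (fun θ => by simp) fun θ => (sq _).symm

theorem quadGrowth_exp_neg_mul_sin : QuadGrowth fun θ => exp (-(I * θ)) * sin θ := by
  have := quadGrowth_exp_mul_sin.comp_neg
  exact ⟨by simpa using this.1.neg_left, by simpa using this.2.neg_left⟩

theorem quadGrowth_inv_sub_cos_mul_sin (x : ℂ) :
    QuadGrowth fun θ => (x - cos θ)⁻¹ * sin θ := by
  have h1 : (fun θ => (x - cos θ)⁻¹ * sin θ) =O[up] fun θ => exp (-(I * θ)) ^ 2 := by
    have h0 := isBigO_inv_sub_cos x 0
    simp only [add_zero] at h0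
    exact ((h0.trans isBigO_exp_exp_neg).mul isBigO_sin).congr_right fun θ => (sq _).symm
  exact ⟨h1, by simpa using h1.neg_left⟩

/-- This is the cofactor of w in G(θ + η): cubic growth, reduced by one order by the cosine in the
denominator. -/
theorem quadGrowth_specA_div (η : ℂ) (a : Fin 6 → ℂ) (x : ℂ) :
    QuadGrowth fun θ => specA η a (θ + η) / (x - cos (θ + η)) := by
  have e : ∀ θ, exp (-(I * θ)) ^ 3 * exp (I * θ) = exp (-(I * θ)) ^ 2 := fun θ => by
    rw [pow_succ, mul_assoc, ← Complex.exp_add]; simp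
  constructor
  · exact ((isBigO_specA_add η a η).mul (isBigO_inv_sub_cos x η)).congr
      (fun θ => (div_eq_mul_inv _ _).symm) e
  · exact ((isBigO_specA_neg_add η a η).mul (isBigO_inv_sub_cos_neg x η)).congr
      (fun θ => (div_eq_mul_inv _ _).symm) e

theorem quadGrowth_specA_sub_div (η : ℂ) (a : Fin 6 → ℂ) (x : ℂ) :
    QuadGrowth fun θ => specA η a (η - θ) / (x - cos (θ - η)) := by
  convert! (quadGrowth_specA_div η a x).comp_neg using 4 with θ
  · ring
  · rw [← cos_neg]; ring_nf

/-! ### Decay of the weight -/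

theorem eventually_mul_exp_ne_one (c : ℂ) : ∀ᶠ θ in up, c * exp (I * θ) ≠ 1 := by
  have h : Tendsto (fun θ => c * exp (I * θ)) up (𝓝 (c * 0)) := tendsto_exp_up.const_mul c
  rw [mul_zero] at h
  exact h.eventually_ne zero_ne_one

theorem eventually_mul_exp_neg_ne_one (c : ℂ) : ∀ᶠ θ in up, c * exp (-(I * θ)) ≠ 1 := by
  by_cases hc : c = 0
  · simp [hc]
  filter_upwards [tendsto_exp_up.eventually_ne (Ne.symm hc)] with θ h h1
  rw [Complex.exp_neg] at h1
  exact h (by field_simp at h1; exact h1.symm)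

/-- Expresses A(θ) / A(-θ) as a quotient whose numerator and denominator both have finite limits as
z → 0. -/
theorem prod_exp_sub_mul_specA (η : ℂ) (a : Fin 6 → ℂ) (θ : ℂ) :
    (∏ j, (exp (I * θ) - a j * (baseHalf η)⁻¹)) * specA η a θ =
      (∏ j, (1 - a j * (baseHalf η)⁻¹ * exp (I * θ))) * specA η a (-θ) := by
  have e : ∀ j, exp (I * θ) - a j * (baseHalf η)⁻¹ =
      exp (I * θ) * (1 - a j * (baseHalf η)⁻¹ * exp (I * -θ)) := fun j => by
    rw [mul_neg, Complex.exp_neg]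
    field_simp
  rw [specA, specA, Finset.prod_congr rfl fun j _ => e j, Finset.prod_mul_distrib,
    Finset.prod_const, exp_neg_three_mul, exp_neg_three_mul, mul_neg I θ, Complex.exp_neg]
  simp only [Finset.card_univ, Fintype.card_fin]
  field_simp [exp_ne_zero (I * θ)]

/-- The Pearson equation: `core` at θ + η is evaluated from either side. -/
theorem weight_add_two_mul {η : ℂ} (hη : 0 < η.im) (a : Fin 6 → ℂ) {θ : ℂ}
    (h1 : ∀ j, a j * exp (I * θ) ≠ 1) (h2 : ∀ j, a j * exp (-(I * (θ + 2 * η))) ≠ 1) :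
    weight η a (θ + 2 * η) * specA η a (-(θ + η)) = weight η a θ * specA η a (θ + η) := by
  rw [← core_add hη a h1, show θ + η = θ + 2 * η - η by ring, core_sub hη a h2]
  congr 2; ring

/-- By the Pearson equation w(θ + 2η) / w(θ) tends to q³/σ₆ as z → 0, and z⁻² contributes q⁻². The
limit q/σ₆ has modulus below 1 by `hσ`, and ρ is any number strictly between. -/
theorem exists_weight_decay {η : ℂ} (hη : 0 < η.im) (a : Fin 6 → ℂ)
    (hσ : ‖base η‖ < ‖sigma a 6‖) :
    ∃ ρ : ℝ, 0 < ρ ∧ ρ < 1 ∧ ∀ᶠ θ in up,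
      ‖weight η a (θ + 2 * η) * exp (-(I * (θ + 2 * η))) ^ 2‖ ≤
        ρ * ‖weight η a θ * exp (-(I * θ)) ^ 2‖ := by
  set b : Fin 6 → ℂ := fun j => a j * (baseHalf η)⁻¹ with hb
  have hh := baseHalf_ne_zero (η := η)
  have hprod : ∏ j, (0 - b j) = sigma a 6 * (base η ^ 3)⁻¹ := by
    simp only [zero_sub, hb, ← mul_neg]
    rw [Finset.prod_mul_distrib, sigma_six, Finset.prod_const, ← baseHalf_sq]
    simp only [Finset.card_univ, Fintype.card_fin]
    congr 1; rw [← inv_neg, inv_pow]; ring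
  have hσ0 : sigma a 6 ≠ 0 := norm_pos_iff.mp ((norm_nonneg _).trans_lt hσ)
  have hq0 : base η ≠ 0 := base_ne_zero
  have hne : sigma a 6 * (base η ^ 3)⁻¹ ≠ 0 := mul_ne_zero hσ0 (by positivity)
  have hA : Tendsto (fun θ => ∏ j, (1 - b j * exp (I * (θ + η)))) up (𝓝 1) := by
    have := tendsto_finsetProd (Finset.univ : Finset (Fin 6)) fun j _ =>
      ((tendsto_exp_up.comp (tendsto_add_const_up η)).const_mul (b j)).const_sub (1 : ℂ)
    simpa using this
  have hB : Tendsto (fun θ => ∏ j, (exp (I * (θ + η)) - b j)) up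
      (𝓝 (sigma a 6 * (base η ^ 3)⁻¹)) := by
    have := tendsto_finsetProd (Finset.univ : Finset (Fin 6)) fun j _ =>
      (tendsto_exp_up.comp (tendsto_add_const_up η)).sub_const (b j)
    rwa [hprod] at this
  have hR := ((hA.div hB hne).mul_const (base η ^ 2)⁻¹).norm
  have hlim : ‖1 / (sigma a 6 * (base η ^ 3)⁻¹) * (base η ^ 2)⁻¹‖ < 1 := by
    have : 1 / (sigma a 6 * (base η ^ 3)⁻¹) * (base η ^ 2)⁻¹ = base η / sigma a 6 := by
      field_simp
    rw [this, norm_div, div_lt_one (norm_pos_iff.mpr hσ0)]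
    exact hσ
  obtain ⟨ρ, hρ1, hρ2⟩ := exists_between hlim
  refine ⟨ρ, (norm_nonneg _).trans_lt hρ1, hρ2, ?_⟩
  have ev1 : ∀ᶠ θ in up, ∀ j, a j * exp (I * θ) ≠ 1 :=
    eventually_all.mpr fun j => eventually_mul_exp_ne_one _
  have ev2 : ∀ᶠ θ in up, ∀ j, a j * exp (-(I * (θ + 2 * η))) ≠ 1 :=
    eventually_all.mpr fun j =>
      (tendsto_add_const_up (2 * η)).eventually (eventually_mul_exp_neg_ne_one (a j))
  filter_upwards [ev1, ev2, hR.eventually_le_const hρ1, hB.eventually_ne hne,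
    hA.eventually_ne one_ne_zero] with θ h1 h2 h3 h4 h5
  have k1 := weight_add_two_mul hη a h1 h2
  have k2 := prod_exp_sub_mul_specA η a (θ + η)
  have k3 : specA η a (θ + η) ≠ 0 := mul_ne_zero (exp_ne_zero _) h5
  have e0 : exp (-(I * (θ + 2 * η))) ^ 2 = exp (-(I * θ)) ^ 2 * (base η ^ 2)⁻¹ := by
    rw [base, ← Complex.exp_nat_mul, ← Complex.exp_nat_mul, ← Complex.exp_nat_mul,
      ← Complex.exp_neg, ← Complex.exp_add]
    congr 1; push_cast; ring
  have key : weight η a (θ + 2 * η) * ∏ j, (exp (I * (θ + η)) - b j) =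
      weight η a θ * ∏ j, (1 - b j * exp (I * (θ + η))) := by
    refine mul_right_cancel₀ k3 ?_
    simp only [hb]
    linear_combination weight η a (θ + 2 * η) * k2 +
      (∏ j, (1 - a j * (baseHalf η)⁻¹ * exp (I * (θ + η)))) * k1
  have key2 : weight η a (θ + 2 * η) * exp (-(I * (θ + 2 * η))) ^ 2 =
      ((∏ j, (1 - b j * exp (I * (θ + η)))) / (∏ j, (exp (I * (θ + η)) - b j)) * (base η ^ 2)⁻¹) *
        (weight η a θ * exp (-(I * θ)) ^ 2) := by
    rw [e0]
    field_simp
    linear_combination key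
  rw [key2, norm_mul]
  exact mul_le_mul_of_nonneg_right h3 (norm_nonneg _)

/-! ### The lattice sum -/

theorem tendsto_lattice_up {η : ℂ} (hη : 0 < η.im) (θ₀ : ℂ) :
    Tendsto (fun n : ℕ => θ₀ + 2 * n * η) atTop up := by
  refine tendsto_comap_iff.mpr ?_
  have h : Tendsto (fun n : ℕ => θ₀.im + (n : ℝ) * (2 * η.im)) atTop atTop :=
    tendsto_atTop_add_const_left _ _
      (tendsto_natCast_atTop_atTop.atTop_mul_const (by positivity))
  refine h.congr fun n => ?_
  simp [mul_im]; ring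

theorem summable_nat_weight_mul {η : ℂ} (hη : 0 < η.im) (a : Fin 6 → ℂ)
    (hσ : ‖base η‖ < ‖sigma a 6‖) (θ₀ : ℂ) {h : ℂ → ℂ}
    (hh : h =O[up] fun θ => exp (-(I * θ)) ^ 2) :
    Summable fun n : ℕ => weight η a (θ₀ + 2 * n * η) * h (θ₀ + 2 * n * η) := by
  obtain ⟨ρ, -, hρ, hdec⟩ := exists_weight_decay hη a hσ
  have ht := tendsto_lattice_up hη θ₀
  have hs : Summable fun n : ℕ => weight η a (θ₀ + 2 * n * η) *
      exp (-(I * (θ₀ + 2 * n * η))) ^ 2 := by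
    refine summable_of_ratio_norm_eventually_le hρ ?_
    filter_upwards [ht.eventually hdec] with n hn
    have e : θ₀ + 2 * ((n + 1 : ℕ) : ℂ) * η = θ₀ + 2 * n * η + 2 * η := by push_cast; ring
    rwa [e]
  refine summable_of_isBigO_nat' hs ?_
  exact ((isBigO_refl (weight η a) up).mul hh).comp_tendsto ht

/-- The half s → -∞ is the half s → +∞ for the start -θ₀, since w is odd and `QuadGrowth` is
invariant under reflection. -/
theorem summable_weight_mul {η : ℂ} (hη : 0 < η.im) (a : Fin 6 → ℂ)
    (hσ : ‖base η‖ < ‖sigma a 6‖) (θ₀ : ℂ) {h : ℂ → ℂ} (hh : QuadGrowth h) :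
    Summable fun s : ℤ => weight η a (θ₀ + 2 * s * η) * h (θ₀ + 2 * s * η) := by
  refine Summable.of_nat_of_neg (summable_nat_weight_mul hη a hσ θ₀ hh.1) ?_
  refine (summable_nat_weight_mul hη a hσ (-θ₀) hh.2).neg.congr fun n => ?_
  have e : θ₀ + 2 * ((-(n : ℤ) : ℤ) : ℂ) * η = -(-θ₀ + 2 * n * η) := by push_cast; ring
  simp only [e, weight_neg]
  ring

theorem latticeIntegrable_of_quadGrowth {η : ℂ} (hη : 0 < η.im) (a : Fin 6 → ℂ)
    (hσ : ‖base η‖ < ‖sigma a 6‖) (θ₀ : ℂ) {F h : ℂ → ℂ} (hh : QuadGrowth h)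
    (hF : ∀ θ, F θ * sin θ = weight η a θ * h θ) : LatticeIntegrable η θ₀ F := by
  refine ((summable_weight_mul hη a hσ θ₀ hh).mul_left (-2 * sin η)).congr fun s => ?_
  rw [← hF, deltaY_eq]; ring


theorem latticeIntegrable_weight {η : ℂ} (a : Fin 6 → ℂ) (θ₀ : ℂ) (hη : 0 < η.im)
    (hσ : ‖base η‖ < ‖sigma a 6‖) : LatticeIntegrable η θ₀ (weight η a) :=
  latticeIntegrable_of_quadGrowth hη a hσ θ₀ quadGrowth_sin fun _ => rfl

theorem latticeIntegrable_weight_mul_exp {η : ℂ} (a : Fin 6 → ℂ) (θ₀ : ℂ) (hη : 0 < η.im)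
    (hσ : ‖base η‖ < ‖sigma a 6‖) : LatticeIntegrable η θ₀ fun φ => weight η a φ * exp (I * φ) :=
  latticeIntegrable_of_quadGrowth hη a hσ θ₀ quadGrowth_exp_mul_sin fun _ => mul_assoc _ _ _

theorem latticeIntegrable_weight_mul_exp_neg {η : ℂ} (a : Fin 6 → ℂ) (θ₀ : ℂ) (hη : 0 < η.im)
    (hσ : ‖base η‖ < ‖sigma a 6‖) : LatticeIntegrable η θ₀ fun φ => weight η a φ * exp (-(I * φ)) :=
  latticeIntegrable_of_quadGrowth hη a hσ θ₀ quadGrowth_exp_neg_mul_sin fun _ => mul_assoc _ _ _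

theorem latticeIntegrable_stieltjesKernel {η : ℂ} (a : Fin 6 → ℂ) (θ₀ : ℂ) (hη : 0 < η.im)
    (hσ : ‖base η‖ < ‖sigma a 6‖) (x : ℂ) : LatticeIntegrable η θ₀ (stieltjesKernel η a x) :=
  latticeIntegrable_of_quadGrowth hη a hσ θ₀ (quadGrowth_inv_sub_cos_mul_sin x) fun θ => by
    rw [stieltjesKernel]; ring


/-! ### Admissible angles and the telescoping lattice sum -/

theorem countable_cos_preimage (c : ℂ) {G : Set ℂ} (hG : G.Countable) :
    {θ : ℂ | cos (θ + c) ∈ G}.Countable := by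
  have h1 : ∀ y : ℂ, {θ : ℂ | cos (θ + c) = y}.Countable := by
    intro y
    obtain ⟨x, rfl⟩ := cos_surjective y
    have : {θ : ℂ | cos (θ + c) = cos x} ⊆
        (Set.range fun k : ℤ => x - 2 * k * Real.pi - c) ∪
          Set.range fun k : ℤ => 2 * k * Real.pi - x - c := by
      intro θ hθ
      obtain ⟨k, h | h⟩ := cos_eq_cos_iff.mp hθ
      · exact Or.inl ⟨k, by linear_combination h⟩
      · exact Or.inr ⟨k, by linear_combination -h⟩
    exact ((Set.countable_range _).union (Set.countable_range _)).mono this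
  have : {θ : ℂ | cos (θ + c) ∈ G} = ⋃ y ∈ G, {θ : ℂ | cos (θ + c) = y} := by
    ext θ; simp
  rw [this]
  exact hG.biUnion fun y _ => h1 y

/-- Cosine has countable fibres, so the excluded angles are countable. A finite image would make the
remaining ones countable too, and with them ℂ. -/
theorem infinite_cos_image_lattice (η θ₀ : ℂ) :
    (cos '' {θ | sin θ ≠ 0 ∧ cos (θ + η) ∉ latticeSupport η θ₀ ∧
      cos (θ - η) ∉ latticeSupport η θ₀}).Infinite := by
  set S := {θ | sin θ ≠ 0 ∧ cos (θ + η) ∉ latticeSupport η θ₀ ∧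
      cos (θ - η) ∉ latticeSupport η θ₀} with hS
  intro hfin
  have hG : (latticeSupport η θ₀).Countable := Set.countable_range _
  have h1 : S.Countable := by
    refine (countable_cos_preimage 0 hfin.countable).mono fun θ hθ => ?_
    simpa using ⟨θ, hθ, rfl⟩
  have h2 : {θ : ℂ | sin θ = 0}.Countable := by
    refine (countable_cos_preimage (-(Real.pi / 2)) (Set.countable_singleton 0)).mono
      fun θ hθ => ?_
    simpa [← sub_eq_add_neg, cos_sub_pi_div_two] using hθ
  have h3 := countable_cos_preimage η hG
  have h4 := countable_cos_preimage (-η) hG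
  refine not_countable_complex ((((h1.union h2).union h3).union h4).mono fun θ _ => ?_)
  by_contra hc
  simp only [Set.mem_union, Set.mem_ofPred_eq, not_or, ← sub_eq_add_neg] at hc
  exact hc.1.1.1 ⟨hc.1.1.2, hc.1.2, hc.2⟩

theorem latticeInt_add_mul (η θ₀ : ℂ) (F G : ℂ → ℂ) (c : ℂ) (hF : LatticeIntegrable η θ₀ F)
    (hG : LatticeIntegrable η θ₀ G) :
    LatticeIntegrable η θ₀ (fun φ => F φ + c * G φ) ∧
      latticeInt η θ₀ (fun φ => F φ + c * G φ) = latticeInt η θ₀ F + c * latticeInt η θ₀ G := by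
  have h := hF.add (hG.mul_left c)
  have e : (fun s : ℤ => deltaY η (θ₀ + 2 * s * η) *
      (F (θ₀ + 2 * s * η) + c * G (θ₀ + 2 * s * η))) = fun s : ℤ =>
      deltaY η (θ₀ + 2 * s * η) * F (θ₀ + 2 * s * η) +
        c * (deltaY η (θ₀ + 2 * s * η) * G (θ₀ + 2 * s * η)) := by
    funext s; ring
  refine ⟨by rw [LatticeIntegrable, e]; exact h, ?_⟩
  rw [latticeInt, e, Summable.tsum_add hF (hG.mul_left c), tsum_mul_left]
  rfl

theorem latticeInt_defect_eq_zero {η : ℂ} (hη : 0 < η.im) (a : Fin 6 → ℂ)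
    (hσ : ‖base η‖ < ‖sigma a 6‖) {θ₀ : ℂ}
    (hθ₀ : ∀ (j : Fin 6) (n : ℤ), a j * exp (I * θ₀) ≠ base η ^ n ∧
      a j * exp (-(I * θ₀)) ≠ base η ^ n) {θ : ℂ} (hθ : sin θ ≠ 0)
    (h1 : cos (θ + η) ∉ latticeSupport η θ₀) (h2 : cos (θ - η) ∉ latticeSupport η θ₀) :
    latticeInt η θ₀ (defect η a θ) = 0 := by
  have hz : ∀ s : ℤ, exp (I * (θ₀ + 2 * s * η)) = exp (I * θ₀) * base η ^ s := fun s => by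
    rw [base, ← Complex.exp_int_mul, ← Complex.exp_add]; ring_nf
  have p1 : ∀ (s : ℤ) (j : Fin 6), a j * exp (I * (θ₀ + 2 * s * η)) ≠ 1 := fun s j h => by
    refine (hθ₀ j (-s)).1 ?_
    rw [hz, ← mul_assoc] at h
    rw [zpow_neg]
    exact eq_inv_of_mul_eq_one_left h
  have p2 : ∀ (s : ℤ) (j : Fin 6), a j * exp (-(I * (θ₀ + 2 * s * η))) ≠ 1 := fun s j h => by
    refine (hθ₀ j s).2 ?_
    rw [Complex.exp_neg, hz, mul_inv, ← mul_assoc, ← Complex.exp_neg] at h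
    simpa using eq_inv_of_mul_eq_one_left h
  -- The function G at the midpoints θ_s + η. The defect at s is g s - g (s - 1), and a sum over ℤ
  -- is invariant under a shift of the index.
  set g : ℤ → ℂ := fun s => core η a (θ₀ + 2 * s * η + η) / (cos θ - cos (θ₀ + 2 * s * η + η))
    with hg
  have hgs : Summable g := by
    refine (summable_weight_mul hη a hσ θ₀ (quadGrowth_specA_div η a (cos θ))).congr fun s => ?_
    rw [hg]
    simp only
    rw [core_add hη a (p1 s), mul_div_assoc]
  have e : ∀ s : ℤ, deltaY η (θ₀ + 2 * s * η) * defect η a θ (θ₀ + 2 * s * η) =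
      g s - g (s - 1) := fun s => by
    rw [deltaY_mul_defect hη a hθ (fun h => h1 ⟨s, h.symm⟩) (fun h => h2 ⟨s, h.symm⟩) (p1 s) (p2 s)]
    have : θ₀ + 2 * ((s - 1 : ℤ) : ℂ) * η + η = θ₀ + 2 * s * η - η := by push_cast; ring
    simp only [hg, this]
  have hgs' : Summable fun s : ℤ => g (s - 1) := (Equiv.subRight (1 : ℤ)).summable_iff.mpr hgs
  rw [latticeInt, tsum_congr e, Summable.tsum_sub hgs hgs', sub_eq_zero]
  exact ((Equiv.subRight (1 : ℤ)).tsum_eq g).symm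

theorem lattice_stieltjesEquation_iff {η : ℂ} (hη : 0 < η.im) (a : Fin 6 → ℂ)
    (hσ : ‖base η‖ < ‖sigma a 6‖) {θ₀ : ℂ}
    (hθ₀ : ∀ (j : Fin 6) (n : ℤ), a j * exp (I * θ₀) ≠ base η ^ n ∧
      a j * exp (-(I * θ₀)) ≠ base η ^ n) (U : ℂ[X]) :
    StieltjesEquation η a (stieltjes (latticeInt η θ₀) η a)
        {θ | sin θ ≠ 0 ∧ cos (θ + η) ∉ latticeSupport η θ₀ ∧
          cos (θ - η) ∉ latticeSupport η θ₀} U ↔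
      U = explicitU (latticeInt η θ₀) η a :=
  stieltjesEquation_iff hη a (latticeInt_add_mul η θ₀) (infinite_cos_image_lattice η θ₀)
    (latticeIntegrable_weight a θ₀ hη hσ) (latticeIntegrable_weight_mul_exp a θ₀ hη hσ)
    (latticeIntegrable_weight_mul_exp_neg a θ₀ hη hσ) (fun _ h => h.1)
    (fun _ _ => ⟨latticeIntegrable_stieltjesKernel a θ₀ hη hσ _,
      latticeIntegrable_stieltjesKernel a θ₀ hη hσ _⟩)
    (fun _ h => latticeInt_defect_eq_zero hη a hσ hθ₀ h.1 h.2.1 h.2.2) U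

/-! ### Exponential decay along a half-line -/

/-- With b chosen so that exp (-b T) = ρ, the product ‖g r‖ exp (b r) does not increase from r to r
+ T once r ≥ R. A bound on the single window [R, R + T] therefore holds for all r ≥ R. -/
theorem exists_isBigO_exp_of_step {g : ℝ → ℝ} (hg : ContinuousOn g (Set.Ici 0)) {T ρ : ℝ}
    (hT : 0 < T) (hρ0 : 0 < ρ) (hρ : ρ < 1) (h : ∀ᶠ r in atTop, ‖g (r + T)‖ ≤ ρ * ‖g r‖) :
    ∃ b : ℝ, 0 < b ∧ g =O[atTop] fun r => Real.exp (-b * r) := by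
  obtain ⟨R, hR0, hR⟩ : ∃ R : ℝ, 0 ≤ R ∧ ∀ r, R ≤ r → ‖g (r + T)‖ ≤ ρ * ‖g r‖ := by
    obtain ⟨R, hR⟩ := eventually_atTop.mp h
    exact ⟨max R 0, le_max_right _ _, fun r hr => hR r ((le_max_left _ _).trans hr)⟩
  set b := -Real.log ρ / T with hb
  have hb0 : 0 < b := div_pos (neg_pos.mpr (Real.log_neg hρ0 hρ)) hT
  have hbT : Real.exp (b * T) * ρ = 1 := by
    rw [hb, div_mul_cancel₀ _ hT.ne', Real.exp_neg, Real.exp_log hρ0, inv_mul_cancel₀ hρ0.ne']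
  have hcont : ContinuousOn (fun r => ‖g r‖ * Real.exp (b * r)) (Set.Icc R (R + T)) :=
    (hg.norm.mono fun r hr => hR0.trans hr.1).mul (by fun_prop)
  obtain ⟨M, hM⟩ := isCompact_Icc.bddAbove_image hcont
  have hM' : ∀ r ∈ Set.Icc R (R + T), ‖g r‖ * Real.exp (b * r) ≤ M := fun r hr =>
    hM (Set.mem_image_of_mem _ hr)
  have key : ∀ n : ℕ, ∀ r, R ≤ r → r ≤ R + T + n * T → ‖g r‖ * Real.exp (b * r) ≤ M := by
    intro n
    induction n with
    | zero => exact fun r h1 h2 => hM' r ⟨h1, by simpa using h2⟩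
    | succ n ih =>
      intro r h1 h2
      by_cases hr : r ≤ R + T
      · exact hM' r ⟨h1, hr⟩
      · have h3 : R ≤ r - T := by linarith [not_le.mp hr]
        have h4 : r - T ≤ R + T + n * T := by push_cast at h2; linarith
        have h5 := hR _ h3
        rw [sub_add_cancel] at h5
        calc ‖g r‖ * Real.exp (b * r) ≤ (ρ * ‖g (r - T)‖) * Real.exp (b * r) := by gcongr
          _ = ‖g (r - T)‖ * Real.exp (b * (r - T)) * (Real.exp (b * T) * ρ) := by
            rw [show b * r = b * (r - T) + b * T by ring, Real.exp_add]; ring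
          _ ≤ M := by rw [hbT, mul_one]; exact ih _ h3 h4
  refine ⟨b, hb0, IsBigO.of_bound M ?_⟩
  filter_upwards [eventually_ge_atTop R] with r hr
  obtain ⟨n, hn⟩ := exists_nat_ge ((r - (R + T)) / T)
  have h1 := key n r hr (by rw [div_le_iff₀ hT] at hn; linarith)
  rw [Real.norm_of_nonneg (Real.exp_pos _).le, neg_mul, Real.exp_neg, ← div_eq_mul_inv,
    le_div_iff₀ (Real.exp_pos _)]
  exact h1

theorem tendsto_vertical_up (c : ℂ) : Tendsto (fun r : ℝ => c + I * r) atTop up := by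
  refine tendsto_comap_iff.mpr ?_
  exact (tendsto_atTop_add_const_left _ c.im tendsto_id).congr fun r => by simp

theorem integrableOn_vertical {η : ℂ} (hη : 0 < η.im) (hre : η.re = 0) (a : Fin 6 → ℂ)
    (hσ : ‖base η‖ < ‖sigma a 6‖) (c : ℂ) {h : ℂ → ℂ}
    (hh : h =O[up] fun θ => exp (-(I * θ)) ^ 2)
    (hw : ContinuousOn (fun r : ℝ => weight η a (c + I * r)) (Set.Ici 0))
    (hc : ContinuousOn (fun r : ℝ => h (c + I * r)) (Set.Ici 0)) :
    IntegrableOn (fun r : ℝ => weight η a (c + I * r) * h (c + I * r)) (Set.Ioi 0) := by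
  obtain ⟨ρ, hρ0, hρ, hdec⟩ := exists_weight_decay hη a hσ
  have ht := tendsto_vertical_up c
  set g : ℝ → ℝ := fun r => ‖weight η a (c + I * r) * exp (-(I * (c + I * r))) ^ 2‖ with hg
  have hgc : ContinuousOn g (Set.Ici 0) := (hw.mul (by fun_prop)).norm
  -- Since Re η = 0, the step 2η runs along the half-line, and the decay of the weight becomes a
  -- recursion in the real variable r.
  have hηI : η = I * η.im := by apply Complex.ext <;> simp [hre]
  have hstep : ∀ᶠ r in atTop, ‖g (r + 2 * η.im)‖ ≤ ρ * ‖g r‖ := by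
    filter_upwards [ht.eventually hdec] with r hr
    have e : c + I * ((r + 2 * η.im : ℝ) : ℂ) = c + I * r + 2 * η := by
      nth_rewrite 2 [hηI]; push_cast; ring
    simp only [hg, norm_norm, e]
    exact hr
  obtain ⟨b, hb, hO⟩ := exists_isBigO_exp_of_step hgc (by positivity) hρ0 hρ hstep
  have hO2 : (fun r : ℝ => weight η a (c + I * r) * h (c + I * r)) =O[atTop]
      fun r => Real.exp (-b * r) := by
    have h1 := ((isBigO_refl (weight η a) up).mul hh).comp_tendsto ht
    exact h1.trans ((isBigO_norm_left).mp hO)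
  refine integrableOn_Ici_iff_integrableOn_Ioi (by finiteness) |>.mp <|
    ((hw.mul hc).locallyIntegrableOn measurableSet_Ici).integrableOn_of_isBigO_atTop
      hO2 ⟨Set.Ioi b, Ioi_mem_atTop b, exp_neg_integrableOn_Ioi b hb⟩

/-! ### Contour integrals -/

/-- The contour integral of `K dθ`. -/
def pathInt (K : ℂ → ℂ) : ℂ :=
  (∫ t in (-Real.pi)..Real.pi, K (t : ℂ))
    + I * (∫ r in Set.Ioi (0 : ℝ), K (-(Real.pi : ℂ) - I * r))
    - I * (∫ r in Set.Ioi (0 : ℝ), K ((Real.pi : ℂ) - I * r))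

/-- Absolute convergence of the contour integral of `K dθ`. -/
def PathIntegrable (K : ℂ → ℂ) : Prop :=
  IntervalIntegrable (fun t : ℝ => K (t : ℂ)) volume (-Real.pi) Real.pi ∧
    IntegrableOn (fun r : ℝ => K (-(Real.pi : ℂ) - I * r)) (Set.Ioi 0) ∧
    IntegrableOn (fun r : ℝ => K ((Real.pi : ℂ) - I * r)) (Set.Ioi 0)

theorem contourInt_eq (F : ℂ → ℂ) : contourInt F = 1 / 2 * pathInt fun θ => F θ * sin θ := rfl

theorem contourIntegrable_iff (F : ℂ → ℂ) :
    ContourIntegrable F ↔ PathIntegrable fun θ => F θ * sin θ := Iff.rfl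

theorem PathIntegrable.add_mul {K L : ℂ → ℂ} (hK : PathIntegrable K) (hL : PathIntegrable L)
    (c : ℂ) : PathIntegrable (fun θ => K θ + c * L θ) ∧
      pathInt (fun θ => K θ + c * L θ) = pathInt K + c * pathInt L := by
  obtain ⟨k1, k2, k3⟩ := hK
  obtain ⟨l1, l2, l3⟩ := hL
  refine ⟨⟨k1.add (l1.const_mul c), k2.add (l2.const_mul c), k3.add (l3.const_mul c)⟩, ?_⟩
  simp only [pathInt]
  rw [intervalIntegral.integral_add k1 (l1.const_mul c), integral_add k2 (l2.const_mul c),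
    integral_add k3 (l3.const_mul c), intervalIntegral.integral_const_mul, integral_const_mul,
    integral_const_mul]
  ring

theorem contourInt_add_mul (F G : ℂ → ℂ) (c : ℂ) (hF : ContourIntegrable F)
    (hG : ContourIntegrable G) : ContourIntegrable (fun φ => F φ + c * G φ) ∧
      contourInt (fun φ => F φ + c * G φ) = contourInt F + c * contourInt G := by
  rw [contourIntegrable_iff] at *
  have h := hF.add_mul hG c
  have e : (fun φ => (F φ + c * G φ) * sin φ) = fun φ => F φ * sin φ + c * (G φ * sin φ) := by
    funext φ; ring
  rw [e, contourInt_eq, e, h.2, contourInt_eq, contourInt_eq]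
  exact ⟨h.1, by ring⟩

/-- The angles on the contour, up to multiples of `2π`. -/
def contour : Set ℂ := {θ | θ.im = 0 ∨ ∃ r : ℝ, 0 ≤ r ∧ exp (I * θ) = -(Real.exp r : ℂ)}

theorem ofReal_mem_contour (t : ℝ) : (t : ℂ) ∈ contour := Or.inl (ofReal_im t)

theorem pi_sub_mem_contour {r : ℝ} (hr : 0 ≤ r) : (Real.pi : ℂ) - I * r ∈ contour := by
  refine Or.inr ⟨r, hr, ?_⟩
  rw [show I * ((Real.pi : ℂ) - I * r) = Real.pi * I + r by linear_combination (-(r : ℂ)) * I_sq,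
    Complex.exp_add, exp_pi_mul_I, ofReal_exp, neg_one_mul]

theorem neg_pi_sub_mem_contour {r : ℝ} (hr : 0 ≤ r) : -(Real.pi : ℂ) - I * r ∈ contour := by
  refine Or.inr ⟨r, hr, ?_⟩
  rw [show I * (-(Real.pi : ℂ) - I * r) = -(Real.pi * I) + r by
    linear_combination (-(r : ℂ)) * I_sq, Complex.exp_add, Complex.exp_neg, exp_pi_mul_I,
    ofReal_exp]
  norm_num

theorem pathInt_congr {K L : ℂ → ℂ} (h : ∀ θ ∈ contour, K θ = L θ) : pathInt K = pathInt L := by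
  rw [pathInt, pathInt, intervalIntegral.integral_congr fun t _ => h _ (ofReal_mem_contour t),
    setIntegral_congr_fun measurableSet_Ioi fun _ hr => h _ (neg_pi_sub_mem_contour (le_of_lt hr)),
    setIntegral_congr_fun measurableSet_Ioi fun _ hr => h _ (pi_sub_mem_contour (le_of_lt hr))]

theorem PathIntegrable.congr {K L : ℂ → ℂ} (hK : PathIntegrable K)
    (h : ∀ θ ∈ contour, K θ = L θ) : PathIntegrable L :=
  ⟨hK.1.congr fun t _ => h _ (ofReal_mem_contour t),
    hK.2.1.congr_fun (fun _ hr => h _ (neg_pi_sub_mem_contour (le_of_lt hr))) measurableSet_Ioi,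
    hK.2.2.congr_fun (fun _ hr => h _ (pi_sub_mem_contour (le_of_lt hr))) measurableSet_Ioi⟩

theorem cos_mem_contourSupport {θ : ℂ} (hθ : θ ∈ contour) : cos θ ∈ contourSupport := by
  rcases hθ with h | ⟨r, -, h⟩
  · have : θ = (θ.re : ℂ) := by apply Complex.ext <;> simp [h]
    rw [this, ← ofReal_cos]
    exact ⟨ofReal_im _, by rw [ofReal_re]; exact Real.cos_le_one _⟩
  · have : cos θ = ((-(Real.exp r + (Real.exp r)⁻¹) / 2 : ℝ) : ℂ) := by
      rw [cos_eq_exp, h]; push_cast; rw [inv_neg]; ring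
    rw [this]
    refine ⟨ofReal_im _, ?_⟩
    rw [ofReal_re]
    have := Real.exp_pos r
    have : 0 < (Real.exp r)⁻¹ := by positivity
    linarith

/-- The tails run downwards, to z → ∞; oddness of w reflects them onto the upward half-lines of
`integrableOn_vertical`. -/
theorem pathIntegrable_weight_mul {η : ℂ} (hη : 0 < η.im) (hre : η.re = 0) (a : Fin 6 → ℂ)
    (hσ : ‖base η‖ < ‖sigma a 6‖) {h : ℂ → ℂ} (hh : QuadGrowth h)
    (hw : ContinuousOn (weight η a) contour) (hc : ContinuousOn h contour) :
    PathIntegrable fun θ => weight η a θ * h θ := by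
  have path : ∀ c : ℂ, ContinuousOn (fun r : ℝ => c - I * r) (Set.Ici 0) := fun c => by fun_prop
  have e : ∀ (c : ℂ) (r : ℝ), weight η a (c - I * r) * h (c - I * r) =
      -(weight η a (-c + I * r) * h (-(-c + I * r))) := fun c r => by
    rw [show c - I * r = -(-c + I * r) by ring, weight_neg]; ring
  have e1 : ∀ (c : ℂ) (r : ℝ), weight η a (-c + I * r) = -weight η a (c - I * r) := fun c r => by
    rw [← weight_neg]; ring_nf
  have e2 : ∀ (c : ℂ) (r : ℝ), h (-(-c + I * r)) = h (c - I * r) := fun c r => by ring_nf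
  have tail : ∀ c : ℂ, (∀ r : ℝ, 0 ≤ r → c - I * r ∈ contour) →
      IntegrableOn (fun r : ℝ => weight η a (c - I * r) * h (c - I * r)) (Set.Ioi 0) := by
    intro c hcr
    simp only [e c]
    refine (integrableOn_vertical hη hre a hσ (-c) (h := fun θ => h (-θ)) hh.2 ?_ ?_).neg
    · simp only [e1]
      exact (hw.comp (path c) fun r hr => hcr r hr).neg
    · simp only [e2]
      exact hc.comp (path c) fun r hr => hcr r hr
  refine ⟨ContinuousOn.intervalIntegrable ?_, tail _ fun _ => neg_pi_sub_mem_contour,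
    tail _ fun _ => pi_sub_mem_contour⟩
  exact ContinuousOn.comp (g := fun θ => weight η a θ * h θ) (hw.mul hc)
    continuous_ofReal.continuousOn fun t _ => ofReal_mem_contour t

/-! ### Shifting the contour -/

theorem integral_Ioi_comp_add (g : ℝ → ℂ) (τ : ℝ) :
    ∫ r in Set.Ioi (0 : ℝ), g (r + τ) = ∫ r in Set.Ioi τ, g r := by
  have := (measurePreserving_add_right volume τ).setIntegral_preimage_emb
    (measurableEmbedding_addRight τ) g (Set.Ioi τ)
  simpa using this

theorem integrableOn_Ioi_of_comp_add {g : ℝ → ℂ} {τ : ℝ}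
    (h : IntegrableOn (fun r => g (r + τ)) (Set.Ioi 0)) : IntegrableOn g (Set.Ioi τ) := by
  have := (measurePreserving_add_right volume τ).integrableOn_comp_preimage
    (measurableEmbedding_addRight τ) (f := g) (s := Set.Ioi τ)
  rw [Set.preimage_add_const_Ioi, sub_self] at this
  exact this.mp h

/-- Shifting the contour across the rectangle `|Re θ| ≤ π`, `|Im θ| ≤ τ`. -/
theorem pathInt_shift_eq {G : ℂ → ℂ} {τ : ℝ} (hτ : 0 < τ)
    (hG : DifferentiableOn ℂ G {θ | |θ.im| ≤ τ})
    (h1 : PathIntegrable fun θ => G (θ + I * τ)) (h2 : PathIntegrable fun θ => G (θ - I * τ)) :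
    pathInt (fun θ => G (θ + I * τ)) = pathInt fun θ => G (θ - I * τ) := by
  -- The two translates of a tail differ by the vertical segment from c - iτ to c + iτ. These
  -- segments supply the sides of the rectangle, which need not cancel: w changes sign under θ ↦ θ +
  -- 2π.
  have tail : ∀ c : ℂ, IntegrableOn (fun r : ℝ => G (c - I * r + I * τ)) (Set.Ioi 0) →
      IntegrableOn (fun r : ℝ => G (c - I * r - I * τ)) (Set.Ioi 0) →
      (∫ r in Set.Ioi (0 : ℝ), G (c - I * r + I * τ)) -
        (∫ r in Set.Ioi (0 : ℝ), G (c - I * r - I * τ)) = ∫ y in (-τ)..τ, G (c + y * I) := by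
    intro c i1 i2
    set g : ℝ → ℂ := fun r => G (c - I * r) with hg
    have e1 : (fun r : ℝ => G (c - I * r + I * τ)) = fun r => g (r + -τ) := by
      funext r; simp only [hg]; congr 1; push_cast; ring
    have e2 : (fun r : ℝ => G (c - I * r - I * τ)) = fun r => g (r + τ) := by
      funext r; simp only [hg]; congr 1; push_cast; ring
    rw [e1] at i1 ⊢
    rw [e2, integral_Ioi_comp_add, integral_Ioi_comp_add,
      intervalIntegral.integral_Ioi_sub_Ioi (integrableOn_Ioi_of_comp_add i1) (by linarith)]
    have := intervalIntegral.integral_comp_neg (a := -τ) (b := τ) fun r : ℝ => G (c + r * I)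
    rw [neg_neg] at this
    rw [← this]
    refine intervalIntegral.integral_congr fun r _ => ?_
    simp only [hg]; congr 1; push_cast; ring
  have key := integral_boundary_rect_eq_zero_of_differentiableOn G (-Real.pi - τ * I)
    (Real.pi + τ * I) (hG.mono fun θ hθ => by
      have := hθ.2
      simp only [sub_im, neg_im, ofReal_im, mul_im, ofReal_re, I_re, I_im, add_im, mul_one,
        mul_zero, add_zero, zero_add, neg_zero, zero_sub, Set.mem_preimage,
        Set.uIcc_of_le (show -τ ≤ τ by linarith)] at this
      exact abs_le.mpr this)
  have t1 := tail _ h1.2.1 h2.2.1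
  have t2 := tail _ h1.2.2 h2.2.2
  simp only [sub_im, neg_im, ofReal_im, mul_im, ofReal_re, I_re, I_im, add_im, mul_one, sub_re,
    neg_re, mul_re, add_re, mul_zero, add_zero, zero_add, neg_zero, zero_sub, sub_zero,
    smul_eq_mul, ofReal_neg] at key
  rw [← t1, ← t2] at key
  have e1 : ∀ x : ℝ, (x : ℂ) + -(τ : ℂ) * I = x - I * τ := fun x => by ring
  have e2 : ∀ x : ℝ, (x : ℂ) + (τ : ℂ) * I = x + I * τ := fun x => by ring
  simp only [e1, e2] at key
  rw [pathInt, pathInt]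
  linear_combination -key

/-! ### Regularity of the weight -/

theorem differentiableAt_weight {η : ℂ} (hη : 0 < η.im) (a : Fin 6 → ℂ) {θ : ℂ}
    (h1 : ∀ (j : Fin 6) (k : ℕ), a j * exp (I * θ) * base η ^ k ≠ 1)
    (h2 : ∀ (j : Fin 6) (k : ℕ), a j * exp (-(I * θ)) * base η ^ k ≠ 1) :
    DifferentiableAt ℂ (weight η a) θ := by
  have hp := norm_exp_three_lt_one hη
  have hq := norm_base_lt_one hη
  rw [funext (weight_eq hη a)]
  refine DifferentiableAt.fun_div (by fun_prop (disch := assumption))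
    (by fun_prop (disch := assumption)) ?_
  exact Finset.prod_ne_zero_iff.mpr fun j _ =>
    mul_ne_zero (qPoch_ne_zero hq (h1 j)) (qPoch_ne_zero hq (h2 j))

theorem differentiableAt_core {η : ℂ} (hη : 0 < η.im) (a : Fin 6 → ℂ) {θ : ℂ}
    (h1 : ∀ (j : Fin 6) (k : ℕ), a j * baseHalf η * exp (I * θ) * base η ^ k ≠ 1)
    (h2 : ∀ (j : Fin 6) (k : ℕ), a j * baseHalf η * exp (-(I * θ)) * base η ^ k ≠ 1) :
    DifferentiableAt ℂ (core η a) θ := by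
  have hp := norm_exp_three_lt_one hη
  have hq := norm_base_lt_one hη
  rw [funext fun θ => core.eq_1 η a θ]
  refine DifferentiableAt.fun_div (by fun_prop (disch := assumption))
    (by fun_prop (disch := assumption)) ?_
  exact Finset.prod_ne_zero_iff.mpr fun j _ =>
    mul_ne_zero (qPoch_ne_zero hq (h1 j)) (qPoch_ne_zero hq (h2 j))

theorem mul_mul_pow_ne_one {c u q : ℂ} (hc : ‖c‖ < 1) (hu : ‖u‖ ≤ 1) (hq : ‖q‖ < 1) (k : ℕ) :
    c * u * q ^ k ≠ 1 := by
  intro h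
  have h1 : ‖c * u * q ^ k‖ < 1 := by
    rw [norm_mul, norm_mul, norm_pow, mul_assoc]
    calc ‖c‖ * (‖u‖ * ‖q‖ ^ k) ≤ ‖c‖ * (1 * 1) := by
          gcongr; exact pow_le_one₀ (norm_nonneg _) hq.le
      _ < 1 := by simpa using hc
  rw [h, norm_one] at h1
  exact lt_irrefl _ h1

/-- On the tails z is negative, so a pole of the weight from a factor 1 - a_j z q^k would force a_j
to be negative; the slit plane excludes this. -/
theorem mul_neg_ofReal_ne_one {c : ℂ} (hc : c ∈ slitPlane) {y : ℝ} (hy : 0 < y) :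
    c * -(y : ℂ) ≠ 1 := by
  intro h
  have h1 : c = ((-y⁻¹ : ℝ) : ℂ) := by
    have : (y : ℂ) ≠ 0 := ofReal_ne_zero.mpr hy.ne'
    push_cast
    field_simp
    linear_combination -h
  rw [h1, ofReal_mem_slitPlane] at hc
  have := inv_pos.mpr hy
  linarith

theorem base_eq_ofReal {η : ℂ} (hre : η.re = 0) : base η = (Real.exp (-2 * η.im) : ℂ) := by
  have hηI : η = I * η.im := by apply Complex.ext <;> simp [hre]
  rw [base, ofReal_exp]
  congr 1
  rw [hηI]
  push_cast
  simp
  linear_combination (2 * (η.im : ℂ)) * I_sq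

theorem norm_exp_I_mul (θ : ℂ) : ‖exp (I * θ)‖ = Real.exp (-θ.im) := by
  rw [Complex.norm_exp]; simp

theorem norm_exp_neg_I_mul (θ : ℂ) : ‖exp (-(I * θ))‖ = Real.exp θ.im := by
  rw [Complex.norm_exp]; simp

theorem mul_exp_mul_base_pow_ne_one {η : ℂ} (hη : 0 < η.im) (hre : η.re = 0) {c : ℂ}
    (hc : ‖c‖ < 1) (hcs : c ∈ slitPlane) {θ : ℂ} (hθ : θ ∈ contour) (k : ℕ) :
    c * exp (I * θ) * base η ^ k ≠ 1 := by
  rcases hθ with h | ⟨r, -, h⟩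
  · exact mul_mul_pow_ne_one hc (by rw [norm_exp_I_mul, h]; simp) (norm_base_lt_one hη) k
  · have := mul_neg_ofReal_ne_one hcs
      (mul_pos (Real.exp_pos r) (pow_pos (Real.exp_pos (-2 * η.im)) k))
    rw [h, base_eq_ofReal hre]
    push_cast at this ⊢
    convert this using 1
    ring

theorem im_nonpos_of_mem_contour {θ : ℂ} (hθ : θ ∈ contour) : θ.im ≤ 0 := by
  rcases hθ with h | ⟨r, hr, h⟩
  · exact h.le
  · have := norm_exp_I_mul θ
    rw [h, norm_neg, norm_real, Real.norm_of_nonneg (Real.exp_pos r).le] at this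
    linarith [Real.exp_injective this]

theorem mul_exp_neg_mul_base_pow_ne_one {η : ℂ} (hη : 0 < η.im) {c : ℂ}
    (hc : ‖c‖ < 1) {θ : ℂ} (hθ : θ ∈ contour) (k : ℕ) :
    c * exp (-(I * θ)) * base η ^ k ≠ 1 :=
  mul_mul_pow_ne_one hc
    (by rw [norm_exp_neg_I_mul]; exact Real.exp_le_one_iff.mpr (im_nonpos_of_mem_contour hθ))
    (norm_base_lt_one hη) k

theorem continuousOn_weight {η : ℂ} (hη : 0 < η.im) (hre : η.re = 0) {a : Fin 6 → ℂ}
    (ha : ∀ j, ‖a j‖ < 1 ∧ a j ∈ slitPlane) : ContinuousOn (weight η a) contour :=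
  fun _ hθ => (differentiableAt_weight hη a
    (fun j => mul_exp_mul_base_pow_ne_one hη hre (ha j).1 (ha j).2 hθ)
    (fun j => mul_exp_neg_mul_base_pow_ne_one hη (ha j).1 hθ)).continuousAt.continuousWithinAt

/-- In this strip |q^(1/2) z^(±1)| ≤ 1, so |a_j| < 1 prevents every factor of the denominator from
vanishing. -/
theorem differentiableOn_core {η : ℂ} (hη : 0 < η.im) {a : Fin 6 → ℂ} (ha : ∀ j, ‖a j‖ < 1) :
    DifferentiableOn ℂ (core η a) {θ | |θ.im| ≤ η.im} := by
  intro θ hθ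
  have hθ' : |θ.im| ≤ η.im := hθ
  obtain ⟨h1, h2⟩ := abs_le.mp hθ'
  have hb : ‖baseHalf η‖ = Real.exp (-η.im) := by rw [baseHalf, norm_exp_I_mul]
  refine (differentiableAt_core hη a (fun j k => ?_) fun j k => ?_).differentiableWithinAt <;>
  rw [mul_assoc (a j)] <;> refine mul_mul_pow_ne_one (ha j) ?_ (norm_base_lt_one hη) k <;>
  rw [norm_mul, hb]
  · rw [norm_exp_I_mul, ← Real.exp_add]
    exact Real.exp_le_one_iff.mpr (by linarith)
  · rw [norm_exp_neg_I_mul, ← Real.exp_add]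
    exact Real.exp_le_one_iff.mpr (by linarith)

/-! ### The equation for the contour integral -/

theorem contourIntegrable_of_quadGrowth {η : ℂ} (hη : 0 < η.im) (hre : η.re = 0) {a : Fin 6 → ℂ}
    (hσ : ‖base η‖ < ‖sigma a 6‖) (ha : ∀ j, ‖a j‖ < 1 ∧ a j ∈ slitPlane) {F h : ℂ → ℂ}
    (hh : QuadGrowth h) (hc : ContinuousOn h contour)
    (hF : ∀ θ, F θ * sin θ = weight η a θ * h θ) : ContourIntegrable F := by
  rw [contourIntegrable_iff, funext hF]
  exact pathIntegrable_weight_mul hη hre a hσ hh (continuousOn_weight hη hre ha) hc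

theorem contourIntegrable_weight {η : ℂ} (hη : 0 < η.im) (hre : η.re = 0) {a : Fin 6 → ℂ}
    (hσ : ‖base η‖ < ‖sigma a 6‖) (ha : ∀ j, ‖a j‖ < 1 ∧ a j ∈ slitPlane) :
    ContourIntegrable (weight η a) :=
  contourIntegrable_of_quadGrowth hη hre hσ ha quadGrowth_sin (by fun_prop) fun _ => rfl

theorem contourIntegrable_weight_mul_exp {η : ℂ} (hη : 0 < η.im) (hre : η.re = 0)
    {a : Fin 6 → ℂ} (hσ : ‖base η‖ < ‖sigma a 6‖) (ha : ∀ j, ‖a j‖ < 1 ∧ a j ∈ slitPlane) :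
    ContourIntegrable fun φ => weight η a φ * exp (I * φ) :=
  contourIntegrable_of_quadGrowth hη hre hσ ha quadGrowth_exp_mul_sin (by fun_prop)
    fun _ => mul_assoc _ _ _

theorem contourIntegrable_weight_mul_exp_neg {η : ℂ} (hη : 0 < η.im) (hre : η.re = 0)
    {a : Fin 6 → ℂ} (hσ : ‖base η‖ < ‖sigma a 6‖) (ha : ∀ j, ‖a j‖ < 1 ∧ a j ∈ slitPlane) :
    ContourIntegrable fun φ => weight η a φ * exp (-(I * φ)) :=
  contourIntegrable_of_quadGrowth hη hre hσ ha quadGrowth_exp_neg_mul_sin (by fun_prop)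
    fun _ => mul_assoc _ _ _

theorem contourIntegrable_stieltjesKernel {η : ℂ} (hη : 0 < η.im) (hre : η.re = 0)
    {a : Fin 6 → ℂ} (hσ : ‖base η‖ < ‖sigma a 6‖) (ha : ∀ j, ‖a j‖ < 1 ∧ a j ∈ slitPlane)
    {x : ℂ} (hx : x ∉ contourSupport) : ContourIntegrable (stieltjesKernel η a x) := by
  refine contourIntegrable_of_quadGrowth hη hre hσ ha (quadGrowth_inv_sub_cos_mul_sin x) ?_
    fun θ => by rw [stieltjesKernel]; ring
  refine ContinuousOn.mul (ContinuousOn.inv₀ (by fun_prop) fun φ hφ => ?_) (by fun_prop)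
  exact sub_ne_zero.mpr fun h => hx (h ▸ cos_mem_contourSupport hφ)

/-- Im x = Im z (1 - |z|⁻²) / 2, so for |z| > 1 a real x forces z to be real. The slit plane then
gives z > 1, hence x > 1. -/
theorem cos_notMem_contourSupport {θ : ℂ} (hθ : θ.im < 0) (hs : exp (I * θ) ∈ slitPlane) :
    cos θ ∉ contourSupport := by
  rintro ⟨h1, h2⟩
  have hn : 1 < ‖exp (I * θ)‖ := by rw [norm_exp_I_mul, Real.one_lt_exp_iff]; linarith
  rw [cos_eq_exp] at h1 h2
  generalize exp (I * θ) = z at *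
  have hq : 1 < normSq z := by rw [normSq_eq_norm_sq]; nlinarith
  have h3 : z.im * (1 - (normSq z)⁻¹) = 0 := by
    simp only [div_ofNat_im, add_im, inv_im] at h1
    linear_combination 2 * h1
  have h4 : 1 - (normSq z)⁻¹ ≠ 0 := by
    have := inv_lt_one_of_one_lt₀ hq
    linarith
  have him : z.im = 0 := (mul_eq_zero.mp h3).resolve_right h4
  have hz : z = (z.re : ℂ) := by apply Complex.ext <;> simp [him]
  rw [hz] at hs h2 hn
  rw [ofReal_mem_slitPlane] at hs
  rw [norm_real, Real.norm_of_nonneg hs.le] at hn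
  have h5 : ((z.re : ℂ) + (z.re : ℂ)⁻¹) / 2 = (((z.re + z.re⁻¹) / 2 : ℝ) : ℂ) := by push_cast; ring
  rw [h5, ofReal_re] at h2
  have h6 : z.re * z.re⁻¹ = 1 := mul_inv_cancel₀ hs.ne'
  have h7 := inv_pos.mpr hs
  nlinarith

/-- The angles at which the equation holds for the contour integral. -/
abbrev contourDomain (η : ℂ) : Set ℂ := {θ | θ.im < -η.im ∧ exp (I * θ) ∈ slitPlane}

/-- For imaginary η the shifts by ±η multiply z by positive numbers, which preserves the slit plane;
the bound on `θ.im` keeps both images outside the unit circle. -/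
theorem cos_shift_notMem_contourSupport {η : ℂ} (hη : 0 < η.im) (hre : η.re = 0) {θ : ℂ}
    (hθ : θ ∈ contourDomain η) :
    cos (θ + η) ∉ contourSupport ∧ cos (θ - η) ∉ contourSupport := by
  obtain ⟨h1, h2⟩ := hθ
  have hηI : η = I * η.im := by apply Complex.ext <;> simp [hre]
  have slit : ∀ s : ℝ, exp (I * θ) * (Real.exp s : ℂ) ∈ slitPlane := fun s => by
    rw [mem_slitPlane_iff] at h2 ⊢
    simp only [re_mul_ofReal, im_mul_ofReal]
    exact h2.imp (fun h => mul_pos h (Real.exp_pos s)) fun h => mul_ne_zero h (Real.exp_pos s).ne'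
  have e1 : exp (I * (θ + η)) = exp (I * θ) * (Real.exp (-η.im) : ℂ) := by
    rw [ofReal_exp, ← Complex.exp_add, mul_add]
    congr 2
    nth_rewrite 1 [hηI]
    push_cast
    linear_combination (η.im : ℂ) * I_sq
  have e2 : exp (I * (θ - η)) = exp (I * θ) * (Real.exp η.im : ℂ) := by
    rw [ofReal_exp, ← Complex.exp_add, mul_sub, sub_eq_add_neg]
    congr 2
    nth_rewrite 1 [hηI]
    linear_combination (-(η.im : ℂ)) * I_sq
  exact ⟨cos_notMem_contourSupport (by rw [add_im]; linarith) (e1 ▸ slit _),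
    cos_notMem_contourSupport (by rw [sub_im]; linarith) (e2 ▸ slit _)⟩

theorem cos_ne_cos_of_abs_im_lt {θ φ : ℂ} (h : |φ.im| < |θ.im|) : cos θ ≠ cos φ := by
  intro he
  obtain ⟨k, rfl | rfl⟩ := cos_eq_cos_iff.mp he <;> simp [mul_im] at h

theorem infinite_cos_image_contourDomain {η : ℂ} (hη : 0 < η.im) :
    (cos '' contourDomain η).Infinite := by
  have hf : Function.Injective fun n : ℕ => ((Real.cosh (η.im + 1 + n) : ℝ) : ℂ) := by
    intro m n h
    have h1 : Real.cosh (η.im + 1 + m) = Real.cosh (η.im + 1 + n) := ofReal_injective h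
    have h2 := Real.cosh_strictMonoOn.injOn (Set.mem_Ici.mpr (by positivity))
      (Set.mem_Ici.mpr (by positivity)) h1
    exact_mod_cast add_left_cancel h2
  refine Set.infinite_of_injective_forall_mem hf fun n => ?_
  -- On the negative imaginary axis z is positive and the cosine becomes a hyperbolic cosine.
  refine ⟨-(((η.im + 1 + n : ℝ) : ℂ) * I), ⟨?_, ?_⟩, ?_⟩
  · have : (0 : ℝ) ≤ n := n.cast_nonneg
    simp only [neg_im, mul_im, ofReal_re, I_im, ofReal_im, I_re]
    linarith
  · rw [show I * -(((η.im + 1 + n : ℝ) : ℂ) * I) = ((η.im + 1 + n : ℝ) : ℂ) by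
      linear_combination (-((η.im + 1 + n : ℝ) : ℂ)) * I_sq, ← ofReal_exp, ofReal_mem_slitPlane]
    exact Real.exp_pos _
  · rw [cos_neg, cos_mul_I, ofReal_cosh]

theorem contourInt_defect_eq_zero {η : ℂ} (hη : 0 < η.im) (hre : η.re = 0) {a : Fin 6 → ℂ}
    (hσ : ‖base η‖ < ‖sigma a 6‖) (ha : ∀ j, ‖a j‖ < 1 ∧ a j ∈ slitPlane) {θ : ℂ}
    (hθ : θ ∈ contourDomain η) : contourInt (defect η a θ) = 0 := by
  have hηI : η = I * η.im := by apply Complex.ext <;> simp [hre]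
  obtain ⟨hc1, hc2⟩ := cos_shift_notMem_contourSupport hη hre hθ
  have him : θ.im < -η.im := hθ.1
  have hsin : sin θ ≠ 0 := sin_ne_zero_of_im_ne_zero (by linarith)
  have ne1 : ∀ φ ∈ contour, cos (θ + η) ≠ cos φ := fun φ hφ h =>
    hc1 (h ▸ cos_mem_contourSupport hφ)
  have ne2 : ∀ φ ∈ contour, cos (θ - η) ≠ cos φ := fun φ hφ h =>
    hc2 (h ▸ cos_mem_contourSupport hφ)
  have ne3 : ∀ φ ∈ contour, cos θ - cos (φ + η) ≠ 0 ∧ cos θ - cos (φ - η) ≠ 0 := fun φ hφ => by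
    rw [← mul_ne_zero_iff, cos_sub_cos_mul]
    exact mul_ne_zero (sub_ne_zero.mpr (ne1 φ hφ)) (sub_ne_zero.mpr (ne2 φ hφ))
  have p1 : ∀ φ ∈ contour, ∀ j, a j * exp (I * φ) ≠ 1 := fun φ hφ j => by
    simpa using mul_exp_mul_base_pow_ne_one hη hre (ha j).1 (ha j).2 hφ 0
  have p2 : ∀ φ ∈ contour, ∀ j, a j * exp (-(I * φ)) ≠ 1 := fun φ hφ j => by
    simpa using mul_exp_neg_mul_base_pow_ne_one hη (ha j).1 hφ 0
  have hw := continuousOn_weight hη hre ha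
  have cA : Continuous (specA η a) := by unfold specA; fun_prop
  set G : ℂ → ℂ := fun φ => core η a φ / (cos θ - cos φ) with hG
  have i1 : PathIntegrable fun φ => G (φ + η) := by
    refine (pathIntegrable_weight_mul hη hre a hσ (quadGrowth_specA_div η a (cos θ)) hw ?_).congr
      fun φ hφ => ?_
    · exact ContinuousOn.div (by fun_prop) (by fun_prop) fun φ hφ => (ne3 φ hφ).1
    · simp only [hG, core_add hη a (p1 φ hφ), mul_div_assoc]
  have i2 : PathIntegrable fun φ => G (φ - η) := by
    refine (pathIntegrable_weight_mul hη hre a hσ (quadGrowth_specA_sub_div η a (cos θ)) hw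
      ?_).congr fun φ hφ => ?_
    · exact ContinuousOn.div (by fun_prop) (by fun_prop) fun φ hφ => (ne3 φ hφ).2
    · simp only [hG, core_sub hη a (p2 φ hφ), mul_div_assoc]
  -- The zeros of cos θ - cos φ have |Im φ| = |Im θ| > Im η, so they lie outside the strip. This
  -- uses |z| > q^(-1/2).
  have hGd : DifferentiableOn ℂ G {φ | |φ.im| ≤ η.im} := by
    refine (differentiableOn_core hη fun j => (ha j).1).div (by fun_prop) fun φ hφ => ?_
    refine sub_ne_zero.mpr (cos_ne_cos_of_abs_im_lt (lt_of_le_of_lt hφ ?_))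
    rw [abs_of_neg (by linarith)]
    linarith
  have hshift : pathInt (fun φ => G (φ + η)) = pathInt fun φ => G (φ - η) := by
    have := pathInt_shift_eq hη hGd (by rwa [← hηI]) (by rwa [← hηI])
    rwa [← hηI] at this
  have hs : -2 * sin η ≠ 0 := mul_ne_zero (by norm_num) (sin_ne_zero_of_im_ne_zero hη.ne')
  have hlin := i1.add_mul i2 (-1)
  -- A scalar multiple λK is again formed as K + (λ - 1) K. The factor λ = (-2 sin η)⁻¹ trades Δy(φ)
  -- = -2 sin η sin φ for the sin φ of the contour integral.
  have hlin2 := hlin.1.add_mul hlin.1 ((-2 * sin η)⁻¹ - 1)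
  have e : pathInt (fun φ => defect η a θ φ * sin φ) =
      pathInt fun φ => (G (φ + η) + -1 * G (φ - η)) +
        ((-2 * sin η)⁻¹ - 1) * (G (φ + η) + -1 * G (φ - η)) := by
    refine pathInt_congr fun φ hφ => ?_
    have := deltaY_mul_defect hη a hsin (ne1 φ hφ) (ne2 φ hφ) (p1 φ hφ) (p2 φ hφ)
    rw [deltaY_eq] at this
    have h3 : defect η a θ φ * sin φ =
        (-2 * sin η)⁻¹ * (-2 * sin η * sin φ * defect η a θ φ) := by
      rw [mul_assoc (-2 * sin η), inv_mul_cancel_left₀ hs, mul_comm]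
    rw [h3, this]
    simp only [hG]
    ring
  rw [contourInt_eq, e, hlin2.2, hlin.2, hshift]
  ring

theorem contour_stieltjesEquation_iff {η : ℂ} (hη : 0 < η.im) (hre : η.re = 0) {a : Fin 6 → ℂ}
    (hσ : ‖base η‖ < ‖sigma a 6‖) (ha : ∀ j, ‖a j‖ < 1 ∧ a j ∈ slitPlane) (U : ℂ[X]) :
    StieltjesEquation η a (stieltjes contourInt η a) (contourDomain η) U ↔
      U = explicitU contourInt η a :=
  stieltjesEquation_iff hη a contourInt_add_mul (infinite_cos_image_contourDomain hη)
    (contourIntegrable_weight hη hre hσ ha) (contourIntegrable_weight_mul_exp hη hre hσ ha)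
    (contourIntegrable_weight_mul_exp_neg hη hre hσ ha)
    (fun _ h => sin_ne_zero_of_im_ne_zero (by linarith [h.1]))
    (fun _ h => ⟨contourIntegrable_stieltjesKernel hη hre hσ ha
        (cos_shift_notMem_contourSupport hη hre h).1,
      contourIntegrable_stieltjesKernel hη hre hσ ha
        (cos_shift_notMem_contourSupport hη hre h).2⟩)
    (fun _ h => contourInt_defect_eq_zero hη hre hσ ha h) U

end

end QQuadratic

/-! ### The theorem for both supports -/

theorem mainTheorem9 (η : ℂ) (hη : 0 < η.im) (a : Fin 6 → ℂ)
    (hσ : ‖QQuadratic.base η‖ < ‖QQuadratic.sigma a 6‖) :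
    -- the lattice realisation of the support
    (∀ θ₀ : ℂ,
      (∀ (j : Fin 6) (n : ℤ), a j * Complex.exp (Complex.I * θ₀) ≠ QQuadratic.base η ^ n ∧
        a j * Complex.exp (-(Complex.I * θ₀)) ≠ QQuadratic.base η ^ n) →
      QQuadratic.LatticeIntegrable η θ₀ (QQuadratic.weight η a) ∧
      QQuadratic.LatticeIntegrable η θ₀
        (fun φ => QQuadratic.weight η a φ * Complex.exp (Complex.I * φ)) ∧
      QQuadratic.LatticeIntegrable η θ₀
        (fun φ => QQuadratic.weight η a φ * Complex.exp (-(Complex.I * φ))) ∧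
      (∀ x : ℂ, x ∉ QQuadratic.latticeSupport η θ₀ →
        QQuadratic.LatticeIntegrable η θ₀ (QQuadratic.stieltjesKernel η a x)) ∧
      ∀ U : Polynomial ℂ,
        QQuadratic.StieltjesEquation η a
            (QQuadratic.stieltjes (QQuadratic.latticeInt η θ₀) η a)
            {θ | Complex.sin θ ≠ 0 ∧ Complex.cos (θ + η) ∉ QQuadratic.latticeSupport η θ₀ ∧
              Complex.cos (θ - η) ∉ QQuadratic.latticeSupport η θ₀} U ↔
          U = QQuadratic.explicitU (QQuadratic.latticeInt η θ₀) η a) ∧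
    -- the contour realisation of the support, for `0 < q < 1`
    (η.re = 0 → (∀ j, ‖a j‖ < 1 ∧ a j ∈ Complex.slitPlane) →
      QQuadratic.ContourIntegrable (QQuadratic.weight η a) ∧
      QQuadratic.ContourIntegrable
        (fun φ => QQuadratic.weight η a φ * Complex.exp (Complex.I * φ)) ∧
      QQuadratic.ContourIntegrable
        (fun φ => QQuadratic.weight η a φ * Complex.exp (-(Complex.I * φ))) ∧
      (∀ x : ℂ, x ∉ QQuadratic.contourSupport →
        QQuadratic.ContourIntegrable (QQuadratic.stieltjesKernel η a x)) ∧
      ∀ U : Polynomial ℂ,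
        QQuadratic.StieltjesEquation η a
            (QQuadratic.stieltjes QQuadratic.contourInt η a)
            {θ | θ.im < -η.im ∧ Complex.exp (Complex.I * θ) ∈ Complex.slitPlane} U ↔
          U = QQuadratic.explicitU QQuadratic.contourInt η a) := by
  refine ⟨fun θ₀ hθ₀ => ⟨?_, ?_, ?_, fun x _ => ?_, fun U => ?_⟩,
    fun hre ha => ⟨?_, ?_, ?_, fun x hx => ?_, fun U => ?_⟩⟩
  · exact QQuadratic.latticeIntegrable_weight a θ₀ hη hσ
  · exact QQuadratic.latticeIntegrable_weight_mul_exp a θ₀ hη hσ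
  · exact QQuadratic.latticeIntegrable_weight_mul_exp_neg a θ₀ hη hσ
  · exact QQuadratic.latticeIntegrable_stieltjesKernel a θ₀ hη hσ x
  · exact QQuadratic.lattice_stieltjesEquation_iff hη a hσ hθ₀ U
  · exact QQuadratic.contourIntegrable_weight hη hre hσ ha
  · exact QQuadratic.contourIntegrable_weight_mul_exp hη hre hσ ha
  · exact QQuadratic.contourIntegrable_weight_mul_exp_neg hη hre hσ ha
  · exact QQuadratic.contourIntegrable_stieltjesKernel hη hre hσ ha hx
  · exact QQuadratic.contour_stieltjesEquation_iff hη hre hσ ha U
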